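/- **Notation.** For $a,b\in\{0,1\}$ and $\operatorname{Im}\tau'>0$ let $$\theta_{ab}(z;\tau')=\sum_{n\in\mathbb Z}\exp\Big(\pi i\big(\tfrac a2+n\big)^2\tau'+2\pi i\big(\tfrac a2+n\big)\big(\tfrac b2+z\big)\Big).$$ Let $t>0$, $\tau=i/t$, and write $\theta_{ab}(z)=\theta_{ab}(z;\tau)$. Let $\eta$ be a real number with $2\eta\notin\mathbb Z$, let $\ell\in\{0,\tfrac12,1,\tfrac32,\dots\}$, and let $s=(s_+,s_-)\in\mathbb C^2$. *Representation.* $\Theta^{4\ell+}_{00}$ is the space of entire functions $f$ with $f(z+1)=f(-z)=f(z)$ and $f(z+\tau)=e^{-4\ell\pi i(2z+\tau)}f(z)$. The generators $S^0,\dots,S^3$ of the Sklyanin algebra act on it by $$(\rho^\ell(S^a)f)(z)=\frac{s_a(z-\ell\eta)f(z+\eta)-s_a(-z-\ell\eta)f(z-\eta)}{\theta_{11}(2z)}$$ (removable singularities being filled in by continuity), where $s_0(z)=\theta_{11}(\eta)\theta_{11}(2z)$, $s_1(z)=\theta_{10}(\eta)\theta_{10}(2z)$, $s_2(z)=i\,\theta_{00}(\eta)\theta_{00}(2z)$,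 $s_3(z)=\theta_{01}(\eta)\theta_{01}(2z)$. With the Pauli matrices $\sigma^0=1,\sigma^1,\sigma^2,\sigma^3$, the $L$-operator is the $2\times2$ matrix of operators $L(\lambda)=\sum_{a=0}^3W_a^L(\lambda)\,\rho^\ell(S^a)\otimes\sigma^a$, with $W^L_0(\lambda)=\frac{\theta_{11}(\lambda)}{\theta_{11}(\eta)}$, $W^L_1(\lambda)=\frac{\theta_{10}(\lambda)}{\theta_{10}(\eta)}$, $W^L_2(\lambda)=\frac{\theta_{00}(\lambda)}{\theta_{00}(\eta)}$, $W^L_3(\lambda)=\frac{\theta_{01}(\lambda)}{\theta_{01}(\eta)}$. *Intertwining vectors.* Fix a square root $c$ of $-e^{\pi i(s_+-s_-)}$. For integers $k,k'$ with $k-k'\in\{-2\ell,-2\ell+2,\dots,2\ell\}$ and $\mu\in\mathbb C$ put $$\begin{aligned}\phi_{k,k'}(\mu;s)(z)=a_{k,k'}&\prod_{j=1}^{\ell+\frac{k-k'}2}\theta_{00}\big(z+\tfrac{s_+-\mu}2+\tfrac\tau4+(k'-\ell+2j-1)\eta\big)\,\theta_{00}\big(z-\tfrac{s_+-\mu}2-\tfrac\tau4-(k'-\ell+2j-1)\eta\big)\\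 \times&\prod_{j=1}^{\ell-\frac{k-k'}2}\theta_{00}\big(z+\tfrac{s_-+\mu}2+\tfrac\tau4+(k-\ell+2j-1)\eta\big)\,\theta_{00}\big(z-\tfrac{s_-+\mu}2-\tfrac\tau4-(k-\ell+2j-1)\eta\big),\end{aligned}$$ where $a_{k,k'}=e^{2\pi i\ell(k+k')\eta}\,c^{\,k-k'}$, i.e. $a_{k,k'}=e^{2\pi i\ell(k+k')\eta}\big(-e^{\pi i(s_+-s_-)}\big)^{(k-k')/2}$. Write $\phi_{k,k'}=\phi_{k,k'}(0;s)$. *Gauge transformation.* Let $w_x=\frac{s_++s_-}2+2x\eta-\frac\tau2$ for $x\in\frac12\mathbb Z$. With $x_k=s_+-\lambda+2k\eta$ and $y_k=s_-+\lambda+2k\eta$, let $$M_k(\lambda;s)=\begin{pmatrix}\theta_{11}(-itx_k;2it)&\theta_{11}(-ity_k;2it)\\ \theta_{01}(-itx_k;2it)&\theta_{01}(-ity_k;2it)\end{pmatrix}\begin{pmatrix}e^{-\frac{\pi t}2(x_k-\frac i{2t})^2}&0\\0&e^{-\frac{\pi t}2(y_k-\frac i{2t})^2}\end{pmatrix}\begin{pmatrix}1&0\\0&\theta_{11}(w_k)^{-1}\end{pmatrix},$$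 $$L_{k,k'}(\lambda;s)=\begin{pmatrix}\alpha_{k,k'}&\beta_{k,k'}\\ \gamma_{k,k'}&\delta_{k,k'}\end{pmatrix}=M_k(\lambda;s)^{-1}L(\lambda)M_{k'}(\lambda;s).$$ **Proposition.** The operators $\rho^\ell(S^a)$ map $\Theta^{4\ell+}_{00}$ into itself. Let $k,k'$ be integers with $k-k'\in\{-2\ell,-2\ell+2,\dots,2\ell\}$. Then $\phi_{k,k'}(\mu;s)\in\Theta^{4\ell+}_{00}$ for all $\mu\in\mathbb C$, and for every $\lambda\in\mathbb C$ such that $\theta_{11}(w_k)\ne0$, $\theta_{11}(w_{k'})\neq0$ and $M_k(\lambda;s)$ is invertible, $$\begin{aligned} \alpha_{k,k'}\,\phi_{k,k'}&=2\,\theta_{11}(\lambda+(k-k')\eta)\,\frac{\theta_{11}(w_{(k+k'+2\ell)/2})}{\theta_{11}(w_k)}\;\phi_{k-1,k'-1},\\ \beta_{k,k'}\,\phi_{k,k'}&=2\,\theta_{11}((k'-k-2\ell)\eta)\,\frac{\theta_{11}(w_{(k+k')/2}+\lambda)}{\theta_{11}(w_k)\theta_{11}(w_{k'})}\;\phi_{k-1,k'+1},\\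 \gamma_{k,k'}\,\phi_{k,k'}&=2\,\theta_{11}((k-k'-2\ell)\eta)\,\theta_{11}(w_{(k+k')/2}-\lambda)\;\phi_{k+1,k'-1},\\ \delta_{k,k'}\,\phi_{k,k'}&=2\,\theta_{11}(\lambda-(k-k')\eta)\,\frac{\theta_{11}(w_{(k+k'-2\ell)/2})}{\theta_{11}(w_{k'})}\;\phi_{k+1,k'+1}. \end{aligned}$$ (If $k-k'=-2\ell$ in the second line, or $k-k'=2\ell$ in the third, the coefficient is $\theta_{11}(0)\cdots=0$ and the right-hand side means $0$.) -/

import Mathlib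

namespace EightVertex

open Complex Filter Topology

noncomputable section

/-- Theta function with characteristics
`θ_{ab}(z; τ) = ∑_{n ∈ ℤ} exp(π i (a/2 + n)² τ + 2 π i (a/2 + n)(b/2 + z))`
(absolutely convergent for `Im τ > 0`). -/
def theta (a b : ℕ) (z τ : ℂ) : ℂ :=
  ∑' n : ℤ, cexp (Real.pi * I * ((a : ℂ) / 2 + n) ^ 2 * τ
    + 2 * Real.pi * I * ((a : ℂ) / 2 + n) * ((b : ℂ) / 2 + z))

/-- The purely imaginary elliptic modulus `τ = i / t`. -/
def tau (t : ℝ) : ℂ := I / t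

/-- `θ_{ab}(z) = θ_{ab}(z; τ)` with `τ = i / t`. -/
def th (t : ℝ) (a b : ℕ) (z : ℂ) : ℂ := theta a b z (tau t)

/-- The representation space `Θ^{4ℓ+}_{00}` of spin `ℓ = n / 2`: entire functions with
`f(z + 1) = f(-z) = f(z)` and `f(z + τ) = exp(-4 ℓ π i (2 z + τ)) f(z)`. -/
def thetaSpace (t : ℝ) (n : ℕ) : Submodule ℂ (ℂ → ℂ) where
  carrier := {f | Differentiable ℂ f ∧ (∀ z, f (z + 1) = f z) ∧ (∀ z, f (-z) = f z) ∧
    ∀ z, f (z + tau t)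
      = cexp (-(4 * ((n : ℂ) / 2) * Real.pi * I * (2 * z + tau t))) * f z}
  add_mem' := by
    rintro f g ⟨hf, hf1, hf2, hf3⟩ ⟨hg, hg1, hg2, hg3⟩
    refine ⟨hf.add hg, fun z => ?_, fun z => ?_, fun z => ?_⟩
    · simp [hf1, hg1]
    · simp [hf2, hg2]
    · simp only [Pi.add_apply, hf3, hg3, mul_add]
  zero_mem' := by
    refine ⟨differentiable_const 0, fun z => rfl, fun z => rfl, fun z => ?_⟩
    simp
  smul_mem' := by
    rintro c f ⟨hf, hf1, hf2, hf3⟩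
    refine ⟨hf.const_smul c, fun z => ?_, fun z => ?_, fun z => ?_⟩
    · simp [hf1]
    · simp [hf2]
    · simp only [Pi.smul_apply, hf3, smul_eq_mul]
      ring

/-- The first characteristic attached to the index `a = 0, 1, 2, 3`:
the pairs are `11, 10, 00, 01` respectively. -/
def char₁ : Fin 4 → ℕ := ![1, 1, 0, 0]

/-- The second characteristic attached to the index `a = 0, 1, 2, 3`. -/
def char₂ : Fin 4 → ℕ := ![1, 0, 0, 1]

/-- The coefficient functions `s_a`:
`θ₁₁(η) θ₁₁(2z)`, `θ₁₀(η) θ₁₀(2z)`, `i θ₀₀(η) θ₀₀(2z)`, `θ₀₁(η) θ₀₁(2z)`. -/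
def sCoeff (t η : ℝ) (a : Fin 4) (z : ℂ) : ℂ :=
  (![1, 1, I, 1] : Fin 4 → ℂ) a * th t (char₁ a) (char₂ a) η * th t (char₁ a) (char₂ a) (2 * z)

/-- The action `ρ^ℓ(S^a)`, `ℓ = n / 2`, of the Sklyanin generator `S^a` as a difference operator,
`(ρ^ℓ(S^a) f)(z) = (s_a(z - ℓη) f(z + η) - s_a(-z - ℓη) f(z - η)) / θ₁₁(2z)`.
The quotient has removable singularities at the zeros of `θ₁₁(2z)` when `f` belongs to the
representation space; the limit fills in the values there (and changes nothing elsewhere). -/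
def sklyaninOp (t η : ℝ) (n : ℕ) (a : Fin 4) (f : ℂ → ℂ) : ℂ → ℂ := fun z =>
  limUnder (𝓝[≠] z) fun w =>
    (sCoeff t η a (w - (n : ℂ) / 2 * η) * f (w + η)
      - sCoeff t η a (-w - (n : ℂ) / 2 * η) * f (w - η)) / th t 1 1 (2 * w)

/-- The Pauli matrices `σ⁰, σ¹, σ², σ³`. -/
def pauli : Fin 4 → Matrix (Fin 2) (Fin 2) ℂ :=
  ![!![1, 0; 0, 1], !![0, 1; 1, 0], !![0, -I; I, 0], !![1, 0; 0, -1]]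

/-- The scalar coefficients `W_a^L(λ) = θ_{ab}(λ) / θ_{ab}(η)` of the `L` operator. -/
def weightL (t η : ℝ) (a : Fin 4) (lam : ℂ) : ℂ :=
  th t (char₁ a) (char₂ a) lam / th t (char₁ a) (char₂ a) η

/-- The `(i, j)` entry of `L(λ) = ∑_a W_a^L(λ) ρ^ℓ(S^a) ⊗ σ^a`, acting on functions. -/
def lOp (t η : ℝ) (n : ℕ) (lam : ℂ) (i j : Fin 2) (f : ℂ → ℂ) : ℂ → ℂ :=
  ∑ a : Fin 4, (weightL t η a lam * pauli a i j) • sklyaninOp t η n a f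

/-- `w_x = (s₊ + s₋)/2 + 2 x η - τ/2`; the index may be a half-integer. -/
def wPar (t η : ℝ) (sp sm x : ℂ) : ℂ := (sp + sm) / 2 + 2 * x * η - tau t / 2

/-- The matrix of gauge transformation `M_k(λ; s)`. -/
def gaugeM (t η : ℝ) (sp sm lam : ℂ) (k : ℤ) : Matrix (Fin 2) (Fin 2) ℂ :=
  !![theta 1 1 (-I * t * (sp - lam + 2 * k * η)) (2 * I * t),
      theta 1 1 (-I * t * (sm + lam + 2 * k * η)) (2 * I * t);
     theta 0 1 (-I * t * (sp - lam + 2 * k * η)) (2 * I * t),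
      theta 0 1 (-I * t * (sm + lam + 2 * k * η)) (2 * I * t)]
  * !![cexp (-(Real.pi * t / 2) * (sp - lam + 2 * k * η - I / (2 * t)) ^ 2), 0;
       0, cexp (-(Real.pi * t / 2) * (sm + lam + 2 * k * η - I / (2 * t)) ^ 2)]
  * !![1, 0; 0, (th t 1 1 (wPar t η sp sm k))⁻¹]

/-- The `(i, j)` entry of `L_{k,k'}(λ; s) = M_k(λ; s)⁻¹ L(λ) M_{k'}(λ; s)`, acting on functions.
The entries `(0,0), (0,1), (1,0), (1,1)` are `α, β, γ, δ`. -/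
def twistedL (t η : ℝ) (n : ℕ) (sp sm lam : ℂ) (k k' : ℤ) (i j : Fin 2) (f : ℂ → ℂ) : ℂ → ℂ :=
  ∑ p : Fin 2, ∑ q : Fin 2,
    ((gaugeM t η sp sm lam k)⁻¹ i p * gaugeM t η sp sm lam k' q j) • lOp t η n lam p q f

/-- `k - k' ∈ {-2ℓ, -2ℓ + 2, …, 2ℓ - 2, 2ℓ}` with `2ℓ = n`. -/
def Admissible (n : ℕ) (k k' : ℤ) : Prop :=
  ∃ j : ℕ, j ≤ n ∧ k - k' = 2 * (j : ℤ) - n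

/-- The intertwining vector `φ_{k,k'}(λ; s)` of spin `ℓ = n / 2`, for admissible `k, k'`.
Here `c` is a square root of `-exp(π i (s₊ - s₋))`, so that `c ^ (k - k')` is
`(-exp(π i (s₊ - s₋))) ^ ((k - k') / 2)`.
The two products have `ℓ + (k - k')/2` and `ℓ - (k - k')/2` factors, `j` starting from `1`. -/
def phi (t η : ℝ) (n : ℕ) (sp sm c lam : ℂ) (k k' : ℤ) : ℂ → ℂ := fun z =>
  cexp (2 * Real.pi * I * ((n : ℂ) / 2) * (k + k') * η) * c ^ (k - k')
  * (∏ j ∈ Finset.Icc 1 (((n : ℤ) + (k - k')) / 2).toNat,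
      th t 0 0 (z + (sp - lam) / 2 + tau t / 4 + (k' - (n : ℂ) / 2 + 2 * (j : ℂ) - 1) * η)
      * th t 0 0 (z - (sp - lam) / 2 - tau t / 4 - (k' - (n : ℂ) / 2 + 2 * (j : ℂ) - 1) * η))
  * ∏ j ∈ Finset.Icc 1 (((n : ℤ) - (k - k')) / 2).toNat,
      th t 0 0 (z + (sm + lam) / 2 + tau t / 4 + (k - (n : ℂ) / 2 + 2 * (j : ℂ) - 1) * η)
      * th t 0 0 (z - (sm + lam) / 2 - tau t / 4 - (k - (n : ℂ) / 2 + 2 * (j : ℂ) - 1) * η)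

/-- The SOS weights `W(k, k'; k + ε, k' + ε'; λ)`: row `0` is `ε = -1`, row `1` is `ε = +1`,
column `0` is `ε' = -1`, column `1` is `ε' = +1`. -/
def faceW (t η : ℝ) (n : ℕ) (sp sm lam : ℂ) (k k' : ℤ) : Matrix (Fin 2) (Fin 2) ℂ :=
  !![2 * th t 1 1 (lam + (k - k') * η)
        * (th t 1 1 (wPar t η sp sm ((k + k' + n) / 2)) / th t 1 1 (wPar t η sp sm k)),
      2 * th t 1 1 ((k' - k - n) * η)
        * (th t 1 1 (wPar t η sp sm ((k + k') / 2) + lam)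
          / (th t 1 1 (wPar t η sp sm k) * th t 1 1 (wPar t η sp sm k')));
     2 * th t 1 1 ((k - k' - n) * η) * th t 1 1 (wPar t η sp sm ((k + k') / 2) - lam),
      2 * th t 1 1 (lam - (k - k') * η)
        * (th t 1 1 (wPar t η sp sm ((k + k' - n) / 2)) / th t 1 1 (wPar t η sp sm k'))]

end

end EightVertex

open EightVertex

/-!
The vertex-face correspondence is reduced to theta functions of half the modulus. Put `T = τ / 2`
and attach to a point `w` the vector `v(w) = (θ₀₁(w; T), θ₀₀(w; T))`. Splitting a double series
over `ℤ × ℤ` by the parity of the sum of the indices gives `jacobiTheta₂_mul_add_mul`, and its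
translates by half periods say that the scalar product and the determinant of two such vectors
factor: `v(x) · v(y) = 2 θ₀₀(x + y) θ₀₀(x - y)` and `det (v(x), v(y)) = 2 θ₁₁(x + y) θ₁₁(x - y)`,
with modulus `τ` on the right. Three consequences carry the proof.

* The matrix `∑ₐ θₐ(λ) θₐ(2x) σᵃ` has rank one (`theta_sum_rank_one`), a vector `v(λ/2 + x)` times
  a rotated vector `v(λ/2 - x)`. Hence so has each of the two terms of the `L`-operator
  (`lOp_mul_th`).
* By the modular transformation `T ↦ -1 / T`, the columns of the gauge matrix are multiples of
  `v(x_k / 2 + τ / 4)` and `v(y_k / 2 + τ / 4)` (`gaugeM_eq`), so the entries of `M_k⁻¹ L M_{k'}`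
  are built from products of four values of `θ₀₀` (`twistedL_eq_smul`).
* Lagrange's identity `(a · b)(c · d) - (a · d)(c · b) = det (a, c) det (b, d)` becomes the
  three-term theta relation (`th_three_term`, and `th_antisymm` in the form antisymmetric in `z`).

An intertwining vector is a constant times two strings of products `θ₀₀(z + x) θ₀₀(z - x)` with
`x` in an arithmetic progression of step `2η`. Translating `z` by `η` changes only the ends of the
strings; the factors from the gauge matrices repair the ends so that the neighbouring intertwining
vector splits off (`thetaString_shift_left` and its companions), and `th_antisymm` turns the
remaining difference into `θ₁₁(2z)` times the face weight.

It remains to see that the difference operators preserve entire functions, which needs the zeros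
of `θ₁₁`. If `θ₁₁(z₀) = 0`, the determinant formula shows that `v(w + z₀)` is parallel to `v(w)`
for all `w`. As `v` never vanishes, the ratio is entire, and by Liouville's theorem it is an
exponential, which forces `z₀` into the lattice (`th_one_one_eq_zero`). If the zero at `0` were
not simple, the Wronskian of the components of `v` would vanish (`deriv_th_one_one_zero_ne_zero`).
At half-lattice points the numerator of the difference operator vanishes because it is odd and
quasi-periodic (`eq_zero_of_odd_of_quasiperiodic`), so the quotient by `θ₁₁(2z)` is entire
(`sklyaninOp_spec`).
-/

namespace EightVertex

open Complex Filter Topology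

/-! ### Product formulas for theta functions -/

lemma term_add_half (n : ℤ) (z T : ℂ) :
    jacobiTheta₂_term n (z + 1 / 2) T = (-1) ^ n * jacobiTheta₂_term n z T := by
  rw [← exp_pi_mul_I, ← exp_int_mul, jacobiTheta₂_term, jacobiTheta₂_term, ← Complex.exp_add]
  ring_nf

lemma norm_summable_term (z : ℂ) {T : ℂ} (hT : 0 < T.im) :
    Summable fun n : ℤ => ‖jacobiTheta₂_term n z T‖ :=
  ((summable_jacobiTheta₂_term_iff z T).2 hT).norm

lemma jacobiTheta₂_mul_eq_tsum (z w : ℂ) {T : ℂ} (hT : 0 < T.im) :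
    jacobiTheta₂ z T * jacobiTheta₂ w T =
      ∑' p : ℤ × ℤ, jacobiTheta₂_term p.1 z T * jacobiTheta₂_term p.2 w T :=
  tsum_mul_tsum_of_summable_norm (norm_summable_term z hT) (norm_summable_term w hT)

lemma summable_term_mul (z w : ℂ) {T : ℂ} (hT : 0 < T.im) :
    Summable fun p : ℤ × ℤ => jacobiTheta₂_term p.1 z T * jacobiTheta₂_term p.2 w T :=
  summable_mul_of_summable_norm (f := fun n => jacobiTheta₂_term n z T)
    (g := fun n => jacobiTheta₂_term n w T) (norm_summable_term z hT) (norm_summable_term w hT)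

/-- In the product of the two series the terms with `n + m` odd cancel; the others are indexed by
`(n, m) = (u + v, u - v)`, and `n ^ 2 + m ^ 2 = 2 * (u ^ 2 + v ^ 2)` doubles the modulus. -/
theorem jacobiTheta₂_mul_add_mul (w w' : ℂ) {T : ℂ} (hT : 0 < T.im) :
    jacobiTheta₂ w T * jacobiTheta₂ w' T
      + jacobiTheta₂ (w + 1 / 2) T * jacobiTheta₂ (w' + 1 / 2) T
      = 2 * jacobiTheta₂ (w + w') (2 * T) * jacobiTheta₂ (w - w') (2 * T) := by
  have h2T : 0 < (2 * T).im := by simpa using hT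
  have hg : Function.Injective fun q : ℤ × ℤ => (q.1 + q.2, q.1 - q.2) := by
    rintro ⟨a, b⟩ ⟨a', b'⟩ h
    simp only [Prod.mk.injEq] at h ⊢
    omega
  rw [jacobiTheta₂_mul_eq_tsum _ _ hT, jacobiTheta₂_mul_eq_tsum _ _ hT,
    ← (summable_term_mul _ _ hT).tsum_add (summable_term_mul _ _ hT), mul_assoc,
    jacobiTheta₂_mul_eq_tsum _ _ h2T, ← tsum_mul_left, ← hg.tsum_eq]
  · refine tsum_congr fun ⟨u, v⟩ => ?_
    have hs : ((-1 : ℂ) ^ (u + v)) * (-1) ^ (u - v) = 1 := by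
      rw [← zpow_add₀ (by norm_num), show u + v + (u - v) = 2 * u by ring, zpow_mul]
      norm_num
    have he : jacobiTheta₂_term (u + v) w T * jacobiTheta₂_term (u - v) w' T
        = jacobiTheta₂_term u (w + w') (2 * T) * jacobiTheta₂_term v (w - w') (2 * T) := by
      simp only [jacobiTheta₂_term, ← Complex.exp_add]
      push_cast
      ring_nf
    simp only [term_add_half]
    linear_combination (1 + (-1 : ℂ) ^ (u + v) * (-1) ^ (u - v)) * he
      + jacobiTheta₂_term u (w + w') (2 * T) * jacobiTheta₂_term v (w - w') (2 * T) * hs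
  · -- The terms outside the range of the index map have `n + m` odd and cancel.
    rintro ⟨n, m⟩ hnm
    rw [Function.mem_support] at hnm
    rcases Int.even_or_odd (n + m) with h | h
    · obtain ⟨r, hr⟩ := h
      exact ⟨(r, n - r), by simp only [Prod.mk.injEq]; omega⟩
    · exfalso
      apply hnm
      have hs : ((-1 : ℂ) ^ n) * (-1) ^ m = -1 := by
        rw [← zpow_add₀ (by norm_num), h.neg_one_zpow]
      simp only [term_add_half]
      linear_combination jacobiTheta₂_term n w T * jacobiTheta₂_term m w' T * hs

/-- A theta function with characteristics is, up to an exponential factor, a translate of Mathlib's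
`jacobiTheta₂`. -/
lemma theta_eq (a b : ℕ) (z T : ℂ) :
    theta a b z T = cexp (Real.pi * I * ((a : ℂ) / 2) ^ 2 * T
        + 2 * Real.pi * I * ((a : ℂ) / 2) * ((b : ℂ) / 2 + z))
      * jacobiTheta₂ (z + (b : ℂ) / 2 + (a : ℂ) / 2 * T) T := by
  rw [theta, jacobiTheta₂, ← tsum_mul_left]
  refine tsum_congr fun n => ?_
  rw [jacobiTheta₂_term, ← Complex.exp_add]
  ring_nf

lemma theta_zero_zero (z T : ℂ) : theta 0 0 z T = jacobiTheta₂ z T := by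
  rw [theta_eq]; simp

lemma theta_zero_one (z T : ℂ) : theta 0 1 z T = jacobiTheta₂ (z + 1 / 2) T := by
  rw [theta_eq]; simp

lemma jacobiTheta₂_add_one_half (z T : ℂ) :
    jacobiTheta₂ (z + 1 / 2 + 1 / 2) T = jacobiTheta₂ z T := by
  rw [add_assoc, add_halves, jacobiTheta₂_add_left]

lemma jacobiTheta₂_add_half_add_tau (z T : ℂ) :
    jacobiTheta₂ (z + T + 1 / 2) T
      = -cexp (-Real.pi * I * (T + 2 * z)) * jacobiTheta₂ (z + 1 / 2) T := by
  rw [add_right_comm, jacobiTheta₂_add_left',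
    show -(Real.pi : ℂ) * I * (T + 2 * (z + 1 / 2))
      = -Real.pi * I * (T + 2 * z) + -(Real.pi * I) by ring, Complex.exp_add, Complex.exp_neg,
    exp_pi_mul_I]
  norm_num

lemma two_mul_theta_zero_zero_mul (x y : ℂ) {T : ℂ} (hT : 0 < T.im) :
    2 * (theta 0 0 (x + y) (2 * T) * theta 0 0 (x - y) (2 * T))
      = jacobiTheta₂ x T * jacobiTheta₂ y T
        + jacobiTheta₂ (x + 1 / 2) T * jacobiTheta₂ (y + 1 / 2) T := by
  rw [jacobiTheta₂_mul_add_mul x y hT, theta_zero_zero, theta_zero_zero, mul_assoc]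

lemma two_mul_theta_zero_one_mul (x y : ℂ) {T : ℂ} (hT : 0 < T.im) :
    2 * (theta 0 1 (x + y) (2 * T) * theta 0 1 (x - y) (2 * T))
      = jacobiTheta₂ (x + 1 / 2) T * jacobiTheta₂ y T
        + jacobiTheta₂ x T * jacobiTheta₂ (y + 1 / 2) T := by
  have h := jacobiTheta₂_mul_add_mul (x + 1 / 2) y hT
  rw [jacobiTheta₂_add_one_half] at h
  rw [h, theta_zero_one, theta_zero_one, mul_assoc]
  ring_nf

/-- A product of two theta functions with first characteristic `1` is, up to a factor, the product
on the right of `jacobiTheta₂_mul_add_mul` with its first argument translated by `T`. -/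
lemma theta_one_mul (b : ℕ) (x y T : ℂ) :
    theta 1 b (x + y) (2 * T) * theta 1 b (x - y) (2 * T)
      = cexp (Real.pi * I * (T + 2 * x + b)) *
      (jacobiTheta₂ (x + (b : ℂ) / 2 + T + (y + 0)) (2 * T)
      * jacobiTheta₂ (x + (b : ℂ) / 2 + T - (y + 0)) (2 * T)) := by
  rw [theta_eq, theta_eq, mul_mul_mul_comm, ← Complex.exp_add]
  push_cast
  ring_nf

lemma two_mul_theta_one_zero_mul (x y : ℂ) {T : ℂ} (hT : 0 < T.im) :
    2 * (theta 1 0 (x + y) (2 * T) * theta 1 0 (x - y) (2 * T))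
      = jacobiTheta₂ x T * jacobiTheta₂ y T
        - jacobiTheta₂ (x + 1 / 2) T * jacobiTheta₂ (y + 1 / 2) T := by
  -- Translation by `T` changes the sign of the second product in the double series identity.
  have h := jacobiTheta₂_mul_add_mul (x + T) y hT
  have he : cexp (Real.pi * I * (T + 2 * x)) * cexp (-Real.pi * I * (T + 2 * x)) = 1 := by
    rw [← Complex.exp_add, ← Complex.exp_zero]; ring_nf
  rw [jacobiTheta₂_add_half_add_tau, jacobiTheta₂_add_left'] at h
  rw [theta_one_mul]
  simp only [CharP.cast_eq_zero, zero_div, add_zero]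
  linear_combination -cexp (Real.pi * I * (T + 2 * x)) * h +
    (jacobiTheta₂ x T * jacobiTheta₂ y T
        - jacobiTheta₂ (x + 1 / 2) T * jacobiTheta₂ (y + 1 / 2) T) * he

lemma two_mul_theta_one_one_mul (x y : ℂ) {T : ℂ} (hT : 0 < T.im) :
    2 * (theta 1 1 (x + y) (2 * T) * theta 1 1 (x - y) (2 * T))
      = jacobiTheta₂ (x + 1 / 2) T * jacobiTheta₂ y T
        - jacobiTheta₂ x T * jacobiTheta₂ (y + 1 / 2) T := by
  have h := two_mul_theta_one_zero_mul (x + 1 / 2) y hT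
  rw [jacobiTheta₂_add_one_half, theta_one_mul] at h
  rw [← h, theta_one_mul]
  push_cast
  ring_nf

/-! ### Theta functions of modulus `τ` and `τ / 2` -/

noncomputable section

/-- `θ₀₀(w; τ/2)`, the second component of the vector `v(w)`. -/
def half₀ (t : ℝ) (w : ℂ) : ℂ := jacobiTheta₂ w (tau t / 2)

/-- `θ₀₁(w; τ/2)`, the first component of the vector `v(w)`. -/
def half₁ (t : ℝ) (w : ℂ) : ℂ := jacobiTheta₂ (w + 1 / 2) (tau t / 2)

end

lemma tau_im {t : ℝ} (ht : 0 < t) : 0 < (tau t).im := by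
  rw [tau, div_ofReal_im]; simpa using ht

lemma tau_half_im {t : ℝ} (ht : 0 < t) : 0 < (tau t / 2).im := by
  have := tau_im ht
  rw [show tau t / 2 = tau t / ((2 : ℝ) : ℂ) by norm_num, div_ofReal_im]
  linarith

lemma th_eq (t : ℝ) (a b : ℕ) (z : ℂ) : th t a b z = theta a b z (2 * (tau t / 2)) := by
  rw [th, mul_div_cancel₀ _ two_ne_zero]

section products

variable {t : ℝ} (ht : 0 < t) (x y : ℂ)
include ht

/-- The scalar product of `v(x)` and `v(y)`. -/
lemma two_mul_th_zero_zero_mul :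
    2 * (th t 0 0 (x + y) * th t 0 0 (x - y)) = half₀ t x * half₀ t y + half₁ t x * half₁ t y := by
  simp only [th_eq]
  exact two_mul_theta_zero_zero_mul x y (tau_half_im ht)

lemma two_mul_th_zero_one_mul :
    2 * (th t 0 1 (x + y) * th t 0 1 (x - y)) = half₁ t x * half₀ t y + half₀ t x * half₁ t y := by
  simp only [th_eq]
  exact two_mul_theta_zero_one_mul x y (tau_half_im ht)

lemma two_mul_th_one_zero_mul :
    2 * (th t 1 0 (x + y) * th t 1 0 (x - y)) = half₀ t x * half₀ t y - half₁ t x * half₁ t y := by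
  simp only [th_eq]
  exact two_mul_theta_one_zero_mul x y (tau_half_im ht)

/-- The determinant of `v(x)` and `v(y)`. -/
lemma two_mul_th_one_one_mul :
    2 * (th t 1 1 (x + y) * th t 1 1 (x - y)) = half₁ t x * half₀ t y - half₀ t x * half₁ t y := by
  simp only [th_eq]
  exact two_mul_theta_one_one_mul x y (tau_half_im ht)

end products

/-- The three-term theta relation: Lagrange's identity
`(a · b)(c · d) - (a · d)(c · b) = det (a, c) det (b, d)` for the vectors
`v(a), v(b), v(c), v(d)`. -/
theorem th_three_term {t : ℝ} (ht : 0 < t) (a b c d : ℂ) :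
    th t 0 0 (a + b) * th t 0 0 (a - b) * (th t 0 0 (c + d) * th t 0 0 (c - d))
      - th t 0 0 (a + d) * th t 0 0 (a - d) * (th t 0 0 (c + b) * th t 0 0 (c - b))
      = th t 1 1 (a + c) * th t 1 1 (a - c) * (th t 1 1 (b + d) * th t 1 1 (b - d)) := by
  have e (x y : ℂ) : th t 0 0 (x + y) * th t 0 0 (x - y)
      = (half₀ t x * half₀ t y + half₁ t x * half₁ t y) / 2 := by
    rw [← two_mul_th_zero_zero_mul ht]; ring
  have e' (x y : ℂ) : th t 1 1 (x + y) * th t 1 1 (x - y)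
      = (half₁ t x * half₀ t y - half₀ t x * half₁ t y) / 2 := by
    rw [← two_mul_th_one_one_mul ht]; ring
  simp only [e, e']
  ring

lemma th_zero_zero_neg (t : ℝ) (z : ℂ) : th t 0 0 (-z) = th t 0 0 z := by
  simp only [th, theta_zero_zero, jacobiTheta₂_neg_left]

lemma th_add_tau (t : ℝ) (a b : ℕ) (z : ℂ) :
    th t a b (z + tau t) = (-1) ^ b * cexp (-Real.pi * I * (tau t + 2 * z)) * th t a b z := by
  rw [th, th, theta_eq, theta_eq, add_right_comm z, add_right_comm (z + _),
    jacobiTheta₂_add_left', ← exp_pi_mul_I, ← exp_nat_mul]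
  have h : cexp ((Real.pi * I) * (2 * b)) = 1 :=
    Complex.exp_eq_one_iff.2 ⟨b, by push_cast; ring⟩
  rw [← mul_assoc, ← mul_assoc, ← Complex.exp_add, ← Complex.exp_add, ← Complex.exp_add]
  congr 1
  rw [← one_mul (cexp (_ + _)), ← h, ← Complex.exp_add]
  ring_nf

lemma th_add_one (t : ℝ) (a b : ℕ) (z : ℂ) :
    th t a b (z + 1) = (-1) ^ a * th t a b z := by
  rw [th, th, theta_eq, theta_eq, add_right_comm z, add_right_comm (z + _),
    jacobiTheta₂_add_left, ← exp_pi_mul_I, ← exp_nat_mul, ← mul_assoc, ← Complex.exp_add]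
  ring_nf

lemma th_one_one_neg (t : ℝ) (z : ℂ) : th t 1 1 (-z) = -th t 1 1 z := by
  have h (E : ℂ) : -cexp E = cexp (Real.pi * I + E) := by
    rw [Complex.exp_add, exp_pi_mul_I, neg_one_mul]
  rw [th, th, theta_eq, theta_eq, ← jacobiTheta₂_neg_left (z + _ + _),
    show -z + ((1 : ℕ) : ℂ) / 2 + ((1 : ℕ) : ℂ) / 2 * tau t
      = -(z + ((1 : ℕ) : ℂ) / 2 + ((1 : ℕ) : ℂ) / 2 * tau t) + tau t + 1 by push_cast; ring,
    jacobiTheta₂_add_left, jacobiTheta₂_add_left', ← mul_assoc, ← neg_mul, ← Complex.exp_add, h]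
  congr 1
  rw [Complex.exp_eq_exp_iff_exists_int]
  exact ⟨0, by push_cast; ring⟩

lemma th_one_one_zero (t : ℝ) : th t 1 1 0 = 0 := by
  have := th_one_one_neg t 0
  rw [neg_zero] at this
  exact self_eq_neg.1 this

/-- The three-term relation as the antisymmetrization in `z` of a product of four theta
functions. -/
theorem th_antisymm {t : ℝ} (ht : 0 < t) (p₁ p₂ r₁ r₂ z : ℂ) (h : p₁ + p₂ = r₁ + r₂) :
    th t 0 0 (z + p₁) * th t 0 0 (z + p₂) * (th t 0 0 (-z + r₁) * th t 0 0 (-z + r₂))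
      - th t 0 0 (-z + p₁) * th t 0 0 (-z + p₂) * (th t 0 0 (z + r₁) * th t 0 0 (z + r₂))
      = th t 1 1 (2 * z) * th t 1 1 (p₁ + p₂) * (th t 1 1 (p₁ - r₁) * th t 1 1 (p₁ - r₂)) := by
  have key := th_three_term ht (z + (p₁ + p₂) / 2) ((p₁ - p₂) / 2) (z - (p₁ + p₂) / 2)
    ((r₂ - r₁) / 2)
  obtain rfl : r₂ = p₁ + p₂ - r₁ := by rw [h]; ring
  rw [← th_zero_zero_neg t (-z + r₁), ← th_zero_zero_neg t (-z + (p₁ + p₂ - r₁)),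
    ← th_zero_zero_neg t (-z + p₁), ← th_zero_zero_neg t (-z + p₂)]
  ring_nf at key ⊢
  linear_combination key

/-- The matrix `∑ₐ θₐ(p + m) θₐ(p - m) σᵃ`, with the factor `i` at `a = 2`, has rank one. -/
lemma theta_sum_rank_one {t : ℝ} (ht : 0 < t) (p m : ℂ) (i j : Fin 2) :
    ∑ a : Fin 4, (![1, 1, I, 1] : Fin 4 → ℂ) a * pauli a i j
        * (th t (char₁ a) (char₂ a) (p + m) * th t (char₁ a) (char₂ a) (p - m))
      = (![half₀ t m, -half₁ t m] : Fin 2 → ℂ) i * (![half₁ t p, half₀ t p] : Fin 2 → ℂ) j := by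
  have h0 := two_mul_th_one_one_mul ht p m
  have h1 := two_mul_th_one_zero_mul ht p m
  have h2 := two_mul_th_zero_zero_mul ht p m
  have h3 := two_mul_th_zero_one_mul ht p m
  fin_cases i <;> fin_cases j <;> simp [Fin.sum_univ_four, pauli, char₁, char₂]
  · linear_combination (h0 + h3) / 2
  · linear_combination (h1 + h2) / 2
  · linear_combination (h1 - h2) / 2
  · linear_combination (h0 - h3) / 2

noncomputable section

/-- The factor `(-i τ/2)^{1/2}` in the modular transformation of modulus `τ/2`. -/
def gaugeConst (t : ℝ) : ℂ := (-I * (tau t / 2)) ^ (1 / 2 : ℂ)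

end

lemma gaugeConst_ne_zero {t : ℝ} (ht : 0 < t) : gaugeConst t ≠ 0 := by
  have := tau_half_im ht
  have h : tau t / 2 ≠ 0 := fun h => by simp [h] at this
  rw [gaugeConst, cpow_ne_zero_iff]
  exact Or.inl (by simp [I_ne_zero, h])

/-- The lower entries of the gauge matrix in terms of modulus `τ/2`. -/
lemma theta_zero_one_modular {t : ℝ} (ht : 0 < t) (x : ℂ) :
    theta 0 1 (-I * t * x) (2 * I * t) * cexp (-(Real.pi * t / 2) * (x - I / (2 * t)) ^ 2)
      = gaugeConst t * cexp (Real.pi * I * x) * half₀ t (x / 2 + tau t / 4) := by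
  have ht' : (t : ℂ) ≠ 0 := by exact_mod_cast ht.ne'
  have hκ := gaugeConst_ne_zero ht
  have e1 : (x / 2 + tau t / 4) / (tau t / 2) = -I * t * x + 1 / 2 := by
    rw [tau]; field_simp; ring_nf; simp
  have e2 : -1 / (tau t / 2) = 2 * I * t := by
    rw [tau]; field_simp; ring_nf; simp
  rw [half₀, jacobiTheta₂_functional_equation, e1, e2, theta_zero_one, ← gaugeConst]
  have e3 : cexp (-(Real.pi * t / 2) * (x - I / (2 * t)) ^ 2) = cexp (Real.pi * I * x) *
      cexp (-Real.pi * I * (x / 2 + tau t / 4) ^ 2 / (tau t / 2)) := by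
    rw [← Complex.exp_add, tau]
    congr 1
    field_simp
    ring_nf
  rw [e3]
  field_simp

/-- The upper entries of the gauge matrix in terms of modulus `τ/2`. -/
lemma theta_one_one_modular {t : ℝ} (ht : 0 < t) (x : ℂ) :
    theta 1 1 (-I * t * x) (2 * I * t) * cexp (-(Real.pi * t / 2) * (x - I / (2 * t)) ^ 2)
      = gaugeConst t * cexp (Real.pi * I * x) * half₁ t (x / 2 + tau t / 4) := by
  have ht' : (t : ℂ) ≠ 0 := by exact_mod_cast ht.ne'
  have hκ := gaugeConst_ne_zero ht
  have e1 : (x / 2 + tau t / 4 + 1 / 2) / (tau t / 2) = -I * t * x + 1 / 2 - I * t := by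
    rw [tau]; field_simp; ring_nf; simp
  have e2 : -1 / (tau t / 2) = 2 * I * t := by
    rw [tau]; field_simp; ring_nf; simp
  rw [half₁, jacobiTheta₂_functional_equation, e1, e2, theta_eq, ← gaugeConst]
  rw [show -I * t * x + ((1 : ℕ) : ℂ) / 2 + ((1 : ℕ) : ℂ) / 2 * (2 * I * t)
    = -I * t * x + 1 / 2 - I * t + 2 * I * t by push_cast; ring, jacobiTheta₂_add_left']
  have e3 : cexp (Real.pi * I * (((1 : ℕ) : ℂ) / 2) ^ 2 * (2 * I * t) +
        2 * Real.pi * I * (((1 : ℕ) : ℂ) / 2) * (((1 : ℕ) : ℂ) / 2 + -I * t * x))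
      * cexp (-Real.pi * I * (2 * I * t + 2 * (-I * t * x + 1 / 2 - I * t)))
      * cexp (-(Real.pi * t / 2) * (x - I / (2 * t)) ^ 2) = cexp (Real.pi * I * x) *
      cexp (-Real.pi * I * (x / 2 + tau t / 4 + 1 / 2) ^ 2 / (tau t / 2)) := by
    rw [← Complex.exp_add, ← Complex.exp_add, ← Complex.exp_add, tau]
    congr 1
    push_cast
    field_simp
    ring_nf
    simp
    ring
  have e4 (D E J : ℂ) : gaugeConst t * D * (1 / gaugeConst t * E * J) = D * E * J := by
    field_simp
  rw [e4]
  linear_combination jacobiTheta₂ (-I * t * x + 1 / 2 - I * t) (2 * I * t) * e3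

/-! ### Zeros of `θ₁₁` -/

/-- Iteration of a quasi-periodicity relation over all integer multiples of the period. -/
lemma apply_add_int_mul {F : ℂ → ℂ} {T s m : ℂ} (hs : s ≠ 0)
    (h : ∀ z, F (z + T) = s * cexp (-Real.pi * I * m * (T + 2 * z)) * F z) (b : ℤ) (z : ℂ) :
    F (z + b * T) = s ^ b * cexp (-Real.pi * I * m * (b ^ 2 * T + 2 * b * z)) * F z := by
  have step (b : ℤ) (z : ℂ) : F (z + (b + 1 : ℤ) * T)
      = s * cexp (-Real.pi * I * m * (T + 2 * (z + b * T))) * F (z + b * T) := by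
    rw [← h]; push_cast; ring_nf
  have expo (b : ℤ) : cexp (-Real.pi * I * m * (T + 2 * (z + b * T)))
      * cexp (-Real.pi * I * m * (b ^ 2 * T + 2 * b * z))
      = cexp (-Real.pi * I * m * ((b + 1 : ℤ) ^ 2 * T + 2 * (b + 1 : ℤ) * z)) := by
    rw [← Complex.exp_add]; push_cast; ring_nf
  have iff (b : ℤ) : (F (z + b * T)
        = s ^ b * cexp (-Real.pi * I * m * (b ^ 2 * T + 2 * b * z)) * F z) ↔
      F (z + (b + 1 : ℤ) * T) = s ^ (b + 1)
        * cexp (-Real.pi * I * m * ((b + 1 : ℤ) ^ 2 * T + 2 * (b + 1 : ℤ) * z)) * F z := by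
    have hne := mul_ne_zero hs (Complex.exp_ne_zero (-Real.pi * I * m * (T + 2 * (z + b * T))))
    rw [step, ← expo, zpow_add_one₀ hs, ← mul_right_inj' hne]
    constructor <;> intro h <;> linear_combination h
  induction b using Int.induction_on with
  | zero => simp
  | succ i ih => exact (iff i).1 ih
  | pred i ih =>
    refine (iff _).2 ?_
    rwa [sub_add_cancel]

lemma apply_add_int {F : ℂ → ℂ} {s : ℂ} (hs : s ≠ 0) (h : ∀ z, F (z + 1) = s * F z) (a : ℤ)
    (z : ℂ) : F (z + a) = s ^ a * F z := by
  simpa using apply_add_int_mul (F := F) (T := 1) (m := 0) hs (by simpa using h) a z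

lemma eq_zero_or_eq_zero_of_differentiable {f g : ℂ → ℂ} (hf : Differentiable ℂ f)
    (hg : Differentiable ℂ g) (h : ∀ z, f z * g z = 0) : (∀ z, f z = 0) ∨ ∀ z, g z = 0 := by
  have := AnalyticOnNhd.eq_zero_or_eq_zero_of_mul_eq_zero (𝕜 := ℂ) (U := Set.univ) (f := f) (g := g)
    (fun z _ => hf.analyticAt z) (fun z _ => hg.analyticAt z) (fun z _ => h z)
    isPreconnected_univ
  simpa using this

lemma eq_of_mul_eq_mul {f g h : ℂ → ℂ} (hf : Differentiable ℂ f) (hg : Differentiable ℂ g)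
    (hh : Differentiable ℂ h) (hne : ∃ z, h z ≠ 0) (H : ∀ z, f z * h z = g z * h z) : f = g := by
  rcases eq_zero_or_eq_zero_of_differentiable (hf.sub hg) hh
    (fun z => by simp [sub_mul, H z]) with h0 | h0
  · exact funext fun z => sub_eq_zero.1 (h0 z)
  · exact absurd (h0 _) hne.choose_spec

lemma exists_real_coords {T : ℂ} (hT : 0 < T.im) (z : ℂ) : ∃ a b : ℝ, z = a + b * T := by
  refine ⟨z.re - z.im / T.im * T.re, z.im / T.im, Complex.ext ?_ ?_⟩
  · simp
  · simp [hT.ne']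

/-- Liouville's theorem for an entire function whose modulus is doubly periodic. -/
theorem const_of_norm_doubly_periodic {h : ℂ → ℂ} (hd : Differentiable ℂ h) {T : ℂ}
    (hT : 0 < T.im) (h1 : ∀ z, ‖h (z + 1)‖ = ‖h z‖) (h2 : ∀ z, ‖h (z + T)‖ = ‖h z‖) (z w : ℂ) :
    h z = h w := by
  refine hd.apply_eq_apply_of_bounded ?_ z w
  have hK : IsCompact ((fun p : ℝ × ℝ => (p.1 + p.2 * T : ℂ)) ''
      (Set.Icc (0 : ℝ) 1 ×ˢ Set.Icc (0 : ℝ) 1)) :=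
    (isCompact_Icc.prod isCompact_Icc).image (by fun_prop)
  obtain ⟨C, hC⟩ := (hK.image hd.continuous).isBounded.exists_norm_le
  refine isBounded_iff_forall_norm_le.2 ⟨C, ?_⟩
  rintro _ ⟨u, rfl⟩
  obtain ⟨a, b, rfl⟩ := exists_real_coords hT u
  have p1 : Function.Periodic (fun z => ‖h z‖) 1 := h1
  have p2 : Function.Periodic (fun z => ‖h z‖) T := h2
  have e : ‖h (Int.fract a + Int.fract b * T)‖ = ‖h (a + b * T)‖ := by
    have := (p2.int_mul ⌊b⌋ (Int.fract a + Int.fract b * T + ⌊a⌋ * 1)).trans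
      (p1.int_mul ⌊a⌋ (Int.fract a + Int.fract b * T))
    rw [← this]
    congr 2
    simp only [← Int.self_sub_floor]
    push_cast
    ring
  rw [← e]
  refine hC _ ⟨_, ⟨(Int.fract a, Int.fract b), ⟨?_, ?_⟩, rfl⟩, rfl⟩
  · exact ⟨Int.fract_nonneg _, (Int.fract_lt_one _).le⟩
  · exact ⟨Int.fract_nonneg _, (Int.fract_lt_one _).le⟩

lemma jacobiTheta₂_zero_ne_zero {y : ℝ} (hy : 0 < y) : jacobiTheta₂ 0 (y * I) ≠ 0 := by
  have him : 0 < ((y : ℂ) * I).im := by simpa using hy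
  have ht (n : ℤ) : jacobiTheta₂_term n 0 (y * I)
      = ((Real.exp (-Real.pi * n ^ 2 * y) : ℝ) : ℂ) := by
    rw [jacobiTheta₂_term]
    push_cast
    congr 1
    linear_combination Real.pi * n ^ 2 * y * I_sq
  have hs := (summable_jacobiTheta₂_term_iff 0 (y * I)).2 him
  rw [jacobiTheta₂]
  simp only [ht] at hs ⊢
  rw [← ofReal_tsum, ofReal_ne_zero]
  exact ((Complex.summable_ofReal.1 hs).tsum_pos (fun n => (Real.exp_pos _).le) 0
    (Real.exp_pos _)).ne'

section zeros

variable {t : ℝ} (ht : 0 < t)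
include ht

lemma half₀_zero_ne_zero : half₀ t 0 ≠ 0 := by
  have h : tau t / 2 = ((1 / (2 * t) : ℝ) : ℂ) * I := by
    rw [tau]; push_cast; field_simp
  rw [half₀, h]
  exact jacobiTheta₂_zero_ne_zero (by positivity)

lemma half₁_one_half_ne_zero : half₁ t (1 / 2) ≠ 0 := by
  have h : half₁ t (1 / 2) = half₀ t 0 := by
    rw [half₁, half₀, ← jacobiTheta₂_add_left 0]; norm_num
  rw [h]
  exact half₀_zero_ne_zero ht

lemma differentiable_half₀ : Differentiable ℂ (half₀ t) :=
  fun z => differentiableAt_jacobiTheta₂_fst z (tau_half_im ht)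

lemma differentiable_half₁ : Differentiable ℂ (half₁ t) :=
  (differentiable_half₀ ht).comp (differentiable_id.add_const (1 / 2))

lemma differentiable_th (a b : ℕ) : Differentiable ℂ (th t a b) := by
  have h : Differentiable ℂ fun z => jacobiTheta₂ z (tau t) :=
    fun z => differentiableAt_jacobiTheta₂_fst z (tau_im ht)
  have e : th t a b = fun z => cexp (Real.pi * I * ((a : ℂ) / 2) ^ 2 * tau t
        + 2 * Real.pi * I * ((a : ℂ) / 2) * ((b : ℂ) / 2 + z))
      * jacobiTheta₂ (z + (b : ℂ) / 2 + (a : ℂ) / 2 * tau t) (tau t) :=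
    funext fun z => theta_eq a b z (tau t)
  rw [e]
  exact Differentiable.mul (by fun_prop) (h.comp (by fun_prop))

omit ht in
lemma half₀_add_one (w : ℂ) : half₀ t (w + 1) = half₀ t w := jacobiTheta₂_add_left _ _

omit ht in
lemma half₁_add_one (w : ℂ) : half₁ t (w + 1) = half₁ t w := by
  rw [half₁, add_right_comm, jacobiTheta₂_add_left, half₁]

omit ht in
lemma half₀_add_tau_half (w : ℂ) :
    half₀ t (w + tau t / 2) = cexp (-Real.pi * I * (tau t / 2 + 2 * w)) * half₀ t w :=
  jacobiTheta₂_add_left' _ _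

omit ht in
lemma half₁_add_tau_half (w : ℂ) :
    half₁ t (w + tau t / 2) = -cexp (-Real.pi * I * (tau t / 2 + 2 * w)) * half₁ t w :=
  jacobiTheta₂_add_half_add_tau _ _

/-- If `θ₁₁` vanished identically, all `v(x)` would be parallel; but translation by `τ/2` changes
the sign of one component of `v` relative to the other. -/
lemma exists_th_one_one_ne_zero : ∃ z, th t 1 1 z ≠ 0 := by
  by_contra! h
  have h1 := two_mul_th_one_one_mul ht (1 / 2) 0
  have h2 := two_mul_th_one_one_mul ht (1 / 2 + tau t / 2) 0
  rw [half₁_add_tau_half, half₀_add_tau_half] at h2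
  simp only [h, mul_zero] at h1 h2
  have hne := mul_ne_zero (Complex.exp_ne_zero (-Real.pi * I * (tau t / 2 + 2 * (1 / 2))))
    (mul_ne_zero (half₁_one_half_ne_zero ht) (half₀_zero_ne_zero ht))
  apply hne
  linear_combination (h2 - cexp (-Real.pi * I * (tau t / 2 + 2 * (1 / 2))) * h1) / 2

/-- The vector `v(w)` never vanishes, since otherwise `θ₁₁(x + w) θ₁₁(x - w) = 0` for all `x`. -/
lemma half₀_ne_zero_or_half₁_ne_zero (w : ℂ) : half₀ t w ≠ 0 ∨ half₁ t w ≠ 0 := by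
  by_contra! h
  have hd := differentiable_th ht 1 1
  have := eq_zero_or_eq_zero_of_differentiable (f := fun x => th t 1 1 (x + w))
    (g := fun x => th t 1 1 (x - w)) (hd.comp (by fun_prop)) (hd.comp (by fun_prop)) fun x => by
      have := two_mul_th_one_one_mul ht x w
      rw [h.1, h.2] at this
      simpa using this
  obtain ⟨z, hz⟩ := exists_th_one_one_ne_zero ht
  rcases this with h0 | h0
  · exact hz (by simpa using h0 (z - w))
  · exact hz (by simpa using h0 (z + w))

/-- If `θ₁₁(z₀) = 0`, then `v(w + z₀)` is an entire multiple of `v(w)`. -/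
lemma exists_translation_factor {z₀ : ℂ} (h : th t 1 1 z₀ = 0) :
    ∃ g : ℂ → ℂ, Differentiable ℂ g ∧ (∀ w, g w * half₀ t w = half₀ t (w + z₀)) ∧
      ∀ w, g w * half₁ t w = half₁ t (w + z₀) := by
  have hc := differentiable_half₀ ht
  have hs := differentiable_half₁ ht
  have key (w : ℂ) : half₁ t (w + z₀) * half₀ t w = half₀ t (w + z₀) * half₁ t w := by
    have := two_mul_th_one_one_mul ht (w + z₀) w
    rw [add_sub_cancel_left, h] at this
    linear_combination -this
  classical
  let g : ℂ → ℂ := fun w =>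
    if half₀ t w = 0 then half₁ t (w + z₀) / half₁ t w else half₀ t (w + z₀) / half₀ t w
  have gc (w : ℂ) (hw : half₀ t w ≠ 0) : g w = half₀ t (w + z₀) / half₀ t w := if_neg hw
  have gs (w : ℂ) (hw : half₁ t w ≠ 0) : g w = half₁ t (w + z₀) / half₁ t w := by
    by_cases h0 : half₀ t w = 0
    · exact if_pos h0
    · rw [gc w h0, div_eq_div_iff h0 hw, key]
  refine ⟨g, fun w => ?_, fun w => ?_, fun w => ?_⟩
  · rcases half₀_ne_zero_or_half₁_ne_zero ht w with hw | hw
    · have ev : g =ᶠ[𝓝 w] fun w => half₀ t (w + z₀) / half₀ t w :=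
        (hc.continuous.continuousAt.eventually_ne hw).mono gc
      refine DifferentiableAt.congr_of_eventuallyEq (DifferentiableAt.div ?_ (hc w) hw) ev
      exact (hc.comp (differentiable_id.add_const z₀)) w
    · have ev : g =ᶠ[𝓝 w] fun w => half₁ t (w + z₀) / half₁ t w :=
        (hs.continuous.continuousAt.eventually_ne hw).mono gs
      refine DifferentiableAt.congr_of_eventuallyEq (DifferentiableAt.div ?_ (hs w) hw) ev
      exact (hs.comp (differentiable_id.add_const z₀)) w
  · by_cases hw : half₀ t w = 0
    · have hw' := (half₀_ne_zero_or_half₁_ne_zero ht w).resolve_left (not_not.2 hw)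
      have := key w
      rw [hw, mul_zero, zero_eq_mul] at this
      rw [hw, mul_zero, this.resolve_right hw']
    · rw [gc w hw, div_mul_cancel₀ _ hw]
  · by_cases hw : half₁ t w = 0
    · have hw' := (half₀_ne_zero_or_half₁_ne_zero ht w).resolve_right (not_not.2 hw)
      have := key w
      rw [hw, mul_zero, mul_eq_zero] at this
      rw [hw, mul_zero, this.resolve_right hw']
    · rw [gs w hw, div_mul_cancel₀ _ hw]

/-- The translation factor of a zero is periodic under `1` and multiplied by a constant under
`τ/2`. Times a suitable exponential it has doubly periodic modulus, hence is constant. -/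
lemma zero_mem_half_lattice {z₀ : ℂ} (h : th t 1 1 z₀ = 0) :
    ∃ a b : ℤ, z₀ = a + b * (tau t / 2) := by
  obtain ⟨g, hg, gc, gs⟩ := exists_translation_factor ht h
  have g1 (w : ℂ) : g (w + 1) = g w := by
    have h1 := gc (w + 1)
    have h2 := gs (w + 1)
    rw [add_right_comm, half₀_add_one, half₀_add_one, ← gc] at h1
    rw [add_right_comm, half₁_add_one, half₁_add_one, ← gs] at h2
    rcases half₀_ne_zero_or_half₁_ne_zero ht w with hw | hw
    · exact mul_right_cancel₀ hw h1
    · exact mul_right_cancel₀ hw h2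
  have gT (w : ℂ) : g (w + tau t / 2) = cexp (-2 * Real.pi * I * z₀) * g w := by
    have h1 := gc (w + tau t / 2)
    have h2 := gs (w + tau t / 2)
    have he : cexp (-Real.pi * I * (tau t / 2 + 2 * (w + z₀)))
        = cexp (-Real.pi * I * (tau t / 2 + 2 * w)) * cexp (-2 * Real.pi * I * z₀) := by
      rw [← Complex.exp_add]; ring_nf
    rw [add_right_comm, half₀_add_tau_half, half₀_add_tau_half, ← gc, he] at h1
    rw [add_right_comm, half₁_add_tau_half, half₁_add_tau_half, ← gs, he] at h2
    have hE := Complex.exp_ne_zero (-Real.pi * I * (tau t / 2 + 2 * w))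
    rcases half₀_ne_zero_or_half₁_ne_zero ht w with hw | hw
    · exact mul_right_cancel₀ (mul_ne_zero hE hw) (by linear_combination h1)
    · exact mul_right_cancel₀ (mul_ne_zero hE hw) (by linear_combination -h2)
  -- Real coordinates of `z₀` give multipliers of modulus one after removing an exponential.
  obtain ⟨α, β, rfl⟩ := exists_real_coords (tau_half_im ht) z₀
  have hconst := const_of_norm_doubly_periodic (T := tau t / 2)
    (h := fun w => cexp (2 * Real.pi * I * β * w) * g w)
    (Differentiable.mul (by fun_prop) hg) (tau_half_im ht)
    (fun w => by
      rw [g1, mul_add, Complex.exp_add, mul_one, norm_mul, norm_mul, norm_mul,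
        show 2 * Real.pi * I * β = ((2 * Real.pi * β : ℝ) : ℂ) * I by push_cast; ring,
        Complex.norm_exp_ofReal_mul_I, mul_one])
    (fun w => by
      have e : cexp (2 * Real.pi * I * β * (w + tau t / 2)) *
          cexp (-2 * Real.pi * I * (α + β * (tau t / 2)))
          = cexp (((-2 * Real.pi * α : ℝ) : ℂ) * I) * cexp (2 * Real.pi * I * β * w) := by
        rw [← Complex.exp_add, ← Complex.exp_add]; push_cast; ring_nf
      rw [gT, ← mul_assoc, e, norm_mul, norm_mul, norm_mul, Complex.norm_exp_ofReal_mul_I,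
        one_mul])
  have hg0 : ∃ w, g w ≠ 0 := by
    by_contra! h0
    have := gc (-(α + β * (tau t / 2)))
    rw [h0, zero_mul, neg_add_cancel] at this
    exact half₀_zero_ne_zero ht this.symm
  obtain ⟨w, hw⟩ := hg0
  have c1 := hconst (w + 1) w
  have c2 := hconst (w + tau t / 2) w
  rw [g1, mul_left_inj' hw, Complex.exp_eq_exp_iff_exists_int] at c1
  rw [gT, ← mul_assoc, mul_left_inj' hw, ← Complex.exp_add,
    Complex.exp_eq_exp_iff_exists_int] at c2
  obtain ⟨b, hb⟩ := c1
  obtain ⟨a, ha⟩ := c2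
  have hpi := Complex.two_pi_I_ne_zero
  have hb' : (β : ℂ) = b := mul_left_cancel₀ hpi (by linear_combination hb)
  have ha' : (α : ℂ) = (-a : ℤ) := mul_left_cancel₀ hpi (by push_cast; linear_combination -ha)
  exact ⟨-a, b, by rw [ha', hb']⟩

/-- The zeros of `θ₁₁` lie in `ℤ + ℤ τ`. -/
theorem th_one_one_eq_zero {z₀ : ℂ} (h : th t 1 1 z₀ = 0) :
    ∃ a b : ℤ, z₀ = a + b * tau t := by
  obtain ⟨a, b, rfl⟩ := zero_mem_half_lattice ht h
  rcases Int.even_or_odd' b with ⟨r, rfl | rfl⟩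
  · exact ⟨a, r, by push_cast; ring⟩
  exfalso
  -- Under an odd multiple of `τ/2` the components of `v` get factors of opposite sign, so that
  -- `v(w + z₀)` cannot be parallel to `v(w)`.
  have ec (w : ℂ) : half₀ t (w + (a + (2 * r + 1 : ℤ) * (tau t / 2)))
      = cexp (-Real.pi * I * 1
          * ((2 * r + 1 : ℤ) ^ 2 * (tau t / 2) + 2 * (2 * r + 1 : ℤ) * (w + a)))
        * half₀ t w := by
    rw [← add_assoc, apply_add_int_mul (F := half₀ t) (m := 1) one_ne_zero
      (fun z => by rw [half₀_add_tau_half]; ring_nf),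
      apply_add_int (F := half₀ t) one_ne_zero (fun z => by rw [half₀_add_one, one_mul])]
    simp
  have es (w : ℂ) : half₁ t (w + (a + (2 * r + 1 : ℤ) * (tau t / 2)))
      = -cexp (-Real.pi * I * 1
          * ((2 * r + 1 : ℤ) ^ 2 * (tau t / 2) + 2 * (2 * r + 1 : ℤ) * (w + a)))
        * half₁ t w := by
    rw [← add_assoc, apply_add_int_mul (F := half₁ t) (m := 1) (s := -1) (by norm_num)
      (fun z => by rw [half₁_add_tau_half]; ring_nf),
      apply_add_int (F := half₁ t) one_ne_zero (fun z => by rw [half₁_add_one, one_mul]), one_zpow,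
      Odd.neg_one_zpow ⟨r, rfl⟩]
    ring
  have h0 (w : ℂ) : half₁ t w * half₀ t w = 0 := by
    have := two_mul_th_one_one_mul ht (w + (a + (2 * r + 1 : ℤ) * (tau t / 2))) w
    rw [add_sub_cancel_left, h, ec, es] at this
    refine (mul_eq_zero.1 (?_ : cexp (-Real.pi * I * 1 * ((2 * r + 1 : ℤ) ^ 2 * (tau t / 2)
      + 2 * (2 * r + 1 : ℤ) * (w + a))) * _ = 0)).resolve_left (Complex.exp_ne_zero _)
    linear_combination this / 2
  rcases eq_zero_or_eq_zero_of_differentiable (differentiable_half₁ ht) (differentiable_half₀ ht) h0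
    with h1 | h1
  · exact half₁_one_half_ne_zero ht (h1 _)
  · exact half₀_zero_ne_zero ht (h1 _)

/-- If the zero of `θ₁₁` at the origin were multiple, the Wronskian of the components of `v` would
vanish and they would be proportional, contrary to their behaviour under translation by `τ/2`. -/
lemma deriv_th_one_one_zero_ne_zero : deriv (th t 1 1) 0 ≠ 0 := by
  intro h
  have hc := differentiable_half₀ ht
  have hs := differentiable_half₁ ht
  have hth := differentiable_th ht 1 1
  have W (y : ℂ) : deriv (half₁ t) y * half₀ t y = deriv (half₀ t) y * half₁ t y := by
    have e : (fun x => 2 * (th t 1 1 (x + y) * th t 1 1 (x - y)))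
        = fun x => half₁ t x * half₀ t y - half₀ t x * half₁ t y :=
      funext fun x => two_mul_th_one_one_mul ht x y
    have d2 : HasDerivAt (fun x => half₁ t x * half₀ t y - half₀ t x * half₁ t y)
        (deriv (half₁ t) y * half₀ t y - deriv (half₀ t) y * half₁ t y) y :=
      ((hs y).hasDerivAt.mul_const _).sub ((hc y).hasDerivAt.mul_const _)
    have d0 : HasDerivAt (fun x => th t 1 1 (x - y)) 0 y := by
      have : HasDerivAt (th t 1 1) 0 (y - y) := by
        have := (hth 0).hasDerivAt
        rw [h] at this
        rwa [sub_self]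
      simpa using this.comp_sub_const y y
    have d1 : HasDerivAt (fun x => th t 1 1 (x + y)) (deriv (th t 1 1) (y + y)) y :=
      (hth (y + y)).hasDerivAt.comp_add_const y y
    have d3 := (d1.mul d0).const_mul 2
    have := d3.unique (e ▸ d2)
    rw [sub_self, th_one_one_zero] at this
    linear_combination -this
  obtain ⟨ε, hε, hball⟩ := Metric.eventually_nhds_iff_ball.1
    (hc.continuous.continuousAt.eventually_ne (half₀_zero_ne_zero ht))
  have hq (x : ℂ) (hx : x ∈ Metric.ball (0 : ℂ) ε) :
      HasDerivAt (fun x => half₁ t x / half₀ t x) 0 x := by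
    have := (hs x).hasDerivAt.div (hc x).hasDerivAt (hball x hx)
    rwa [W, mul_comm (half₁ t x), sub_self, zero_div] at this
  have hconst (x : ℂ) (hx : x ∈ Metric.ball (0 : ℂ) ε) :
      half₁ t x / half₀ t x = half₁ t 0 / half₀ t 0 :=
    Metric.isOpen_ball.is_const_of_deriv_eq_zero (convex_ball (0 : ℂ) ε).isPreconnected
      (fun x hx => (hq x hx).differentiableAt.differentiableWithinAt)
      (fun x hx => (hq x hx).deriv) hx (Metric.mem_ball_self hε)
  have heq : half₁ t = fun x => half₁ t 0 / half₀ t 0 * half₀ t x := by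
    refine AnalyticOnNhd.eq_of_eventuallyEq (z₀ := 0) (fun z _ => hs.analyticAt z)
      (fun z _ => (hc.const_mul _).analyticAt z) ?_
    filter_upwards [Metric.ball_mem_nhds (0 : ℂ) hε] with x hx
    rw [← hconst x hx, div_mul_cancel₀ _ (hball x hx)]
  have h1 := congrFun heq (1 / 2 + tau t / 2)
  have h2 := congrFun heq (1 / 2)
  rw [half₁_add_tau_half, half₀_add_tau_half] at h1
  refine mul_ne_zero (Complex.exp_ne_zero (-Real.pi * I * (tau t / 2 + 2 * (1 / 2))))
    (half₁_one_half_ne_zero ht) ?_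
  linear_combination (-h1 + cexp (-Real.pi * I * (tau t / 2 + 2 * (1 / 2))) * h2) / 2

lemma deriv_th_one_one_ne_zero {z₀ : ℂ} (h : th t 1 1 z₀ = 0) : deriv (th t 1 1) z₀ ≠ 0 := by
  obtain ⟨a, b, rfl⟩ := th_one_one_eq_zero ht h
  have hth := differentiable_th ht 1 1
  have e (z : ℂ) : th t 1 1 (z + (a + b * tau t)) = (-1) ^ b *
      cexp (-Real.pi * I * 1 * (b ^ 2 * tau t + 2 * b * (z + a))) * (-1) ^ a * th t 1 1 z := by
    rw [← add_assoc, apply_add_int_mul (F := th t 1 1) (m := 1) (s := -1) (by norm_num)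
      (fun z => by rw [th_add_tau]; ring_nf),
      apply_add_int (F := th t 1 1) (s := -1) (by norm_num) (fun z => by rw [th_add_one]; ring_nf),
      ← mul_assoc]
  have d1 : HasDerivAt (fun z => th t 1 1 (z + (a + b * tau t)))
      (deriv (th t 1 1) (a + b * tau t)) 0 := by
    have : HasDerivAt (th t 1 1) (deriv (th t 1 1) (a + b * tau t)) (0 + (a + b * tau t)) := by
      rw [zero_add]; exact (hth _).hasDerivAt
    exact this.comp_add_const 0 _
  have hE : Differentiable ℂ fun z : ℂ => (-1 : ℂ) ^ b *
      cexp (-Real.pi * I * 1 * (b ^ 2 * tau t + 2 * b * (z + a))) * (-1) ^ a := by fun_prop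
  have d2 := (hE 0).hasDerivAt.mul (hth 0).hasDerivAt
  rw [th_one_one_zero, mul_zero, zero_add] at d2
  rw [funext e] at d1
  rw [d1.unique d2]
  refine mul_ne_zero (mul_ne_zero (mul_ne_zero ?_ (Complex.exp_ne_zero _)) ?_)
    (deriv_th_one_one_zero_ne_zero ht)
  · exact zpow_ne_zero _ (by norm_num)
  · exact zpow_ne_zero _ (by norm_num)

end zeros

/-- An entire function is divisible by an entire function with simple zeros if it vanishes at
these zeros. -/
theorem exists_entire_quotient {N D : ℂ → ℂ} (hN : Differentiable ℂ N) (hD : Differentiable ℂ D)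
    (hs : ∀ z, D z = 0 → deriv D z ≠ 0) (h0 : ∀ z, D z = 0 → N z = 0) :
    ∃ G : ℂ → ℂ, Differentiable ℂ G ∧ ∀ z, G z * D z = N z := by
  classical
  refine ⟨fun z => if D z = 0 then deriv N z / deriv D z else N z / D z, fun p => ?_, fun z => ?_⟩
  · by_cases hp : D p = 0
    · have hslope {F : ℂ → ℂ} (hF : Differentiable ℂ F) : Differentiable ℂ (dslope F p) :=
        differentiableOn_univ.1
          ((Complex.differentiableOn_dslope univ_mem).2 hF.differentiableOn)
      have hval : dslope D p p ≠ 0 := by rw [dslope_same]; exact hs p hp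
      refine DifferentiableAt.congr_of_eventuallyEq
        (DifferentiableAt.div (hslope hN p) (hslope hD p) hval) ?_
      filter_upwards [(hslope hD).continuous.continuousAt.eventually_ne hval] with z hz
      by_cases hzp : z = p
      · subst hzp
        rw [if_pos hp, Pi.div_apply, dslope_same, dslope_same]
      · have hsub := sub_ne_zero.2 hzp
        rw [dslope_of_ne _ hzp, slope_def_field, hp, sub_zero] at hz
        have hz' : D z ≠ 0 := fun h => hz (by rw [h, zero_div])
        rw [if_neg hz', Pi.div_apply, dslope_of_ne _ hzp, dslope_of_ne _ hzp, slope_def_field,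
          slope_def_field, hp, h0 p hp, sub_zero, sub_zero, div_div_div_cancel_right₀ hsub]
    · refine DifferentiableAt.congr_of_eventuallyEq (DifferentiableAt.div (hN p) (hD p) hp) ?_
      filter_upwards [hD.continuous.continuousAt.eventually_ne hp] with z hz
      rw [if_neg hz, Pi.div_apply]
  · by_cases hz : D z = 0
    · simp [hz, h0 z hz]
    · simp [hz]

/-! ### The Sklyanin generators and the `L`-operator -/

lemma sCoeff_add_one (t η : ℝ) (a : Fin 4) (z : ℂ) : sCoeff t η a (z + 1) = sCoeff t η a z := by
  have h : ((-1 : ℂ) ^ char₁ a) * (-1) ^ char₁ a = 1 := by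
    rw [← mul_pow]; norm_num
  rw [sCoeff, sCoeff, show 2 * (z + 1) = 2 * z + 1 + 1 by ring, th_add_one, th_add_one]
  linear_combination (![1, 1, I, 1] : Fin 4 → ℂ) a * th t (char₁ a) (char₂ a) η
    * th t (char₁ a) (char₂ a) (2 * z) * h

lemma th_add_two_mul_tau (t : ℝ) (a b : ℕ) (z : ℂ) :
    th t a b (z + 2 * tau t) = cexp (-Real.pi * I * 4 * (tau t + z)) * th t a b z := by
  have h : ((-1 : ℂ) ^ b) * (-1) ^ b = 1 := by
    rw [← mul_pow]; norm_num
  have e : cexp (-Real.pi * I * 4 * (tau t + z))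
      = cexp (-Real.pi * I * (tau t + 2 * (z + tau t)))
        * cexp (-Real.pi * I * (tau t + 2 * z)) := by
    rw [← Complex.exp_add]; ring_nf
  rw [two_mul, ← add_assoc, th_add_tau, th_add_tau, e]
  linear_combination cexp (-Real.pi * I * (tau t + 2 * (z + tau t)))
    * cexp (-Real.pi * I * (tau t + 2 * z)) * th t a b z * h

lemma sCoeff_add_tau (t η : ℝ) (a : Fin 4) (z : ℂ) :
    sCoeff t η a (z + tau t) = cexp (-Real.pi * I * 4 * (tau t + 2 * z)) * sCoeff t η a z := by
  rw [sCoeff, sCoeff, mul_add, th_add_two_mul_tau]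
  ring

lemma differentiable_sCoeff {t : ℝ} (ht : 0 < t) (η : ℝ) (a : Fin 4) :
    Differentiable ℂ (sCoeff t η a) :=
  ((differentiable_th ht _ _).comp (differentiable_id.const_mul 2)).const_mul _

noncomputable section

/-- The numerator of the difference operator `ρ^ℓ(S^a)` applied to `f`. -/
def sklyaninNum (t η : ℝ) (n : ℕ) (a : Fin 4) (f : ℂ → ℂ) (w : ℂ) : ℂ :=
  sCoeff t η a (w - (n : ℂ) / 2 * η) * f (w + η)
    - sCoeff t η a (-w - (n : ℂ) / 2 * η) * f (w - η)

end

lemma differentiable_sklyaninNum {t : ℝ} (ht : 0 < t) (η : ℝ) (n : ℕ) (a : Fin 4) {f : ℂ → ℂ}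
    (hf : Differentiable ℂ f) : Differentiable ℂ (sklyaninNum t η n a f) := by
  have hs := differentiable_sCoeff ht η a
  exact ((hs.comp (by fun_prop)).mul (hf.comp (by fun_prop))).sub
    ((hs.comp (by fun_prop)).mul (hf.comp (by fun_prop)))

lemma sklyaninNum_neg {t η : ℝ} {n : ℕ} (a : Fin 4) {f : ℂ → ℂ} (hf : f ∈ thetaSpace t n) (z : ℂ) :
    sklyaninNum t η n a f (-z) = -sklyaninNum t η n a f z := by
  rw [sklyaninNum, sklyaninNum, neg_neg, ← hf.2.2.1 (-z + η), ← hf.2.2.1 (-z - η)]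
  ring_nf

lemma sklyaninNum_add_one {t η : ℝ} {n : ℕ} (a : Fin 4) {f : ℂ → ℂ} (hf : f ∈ thetaSpace t n)
    (z : ℂ) : sklyaninNum t η n a f (z + 1) = sklyaninNum t η n a f z := by
  rw [sklyaninNum, sklyaninNum, ← sCoeff_add_one t η a (-(z + 1) - _), ← hf.2.1 (z + η),
    ← hf.2.1 (z - η), ← sCoeff_add_one t η a (z - _)]
  ring_nf

lemma sklyaninNum_add_tau {t η : ℝ} {n : ℕ} (a : Fin 4) {f : ℂ → ℂ} (hf : f ∈ thetaSpace t n)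
    (z : ℂ) : sklyaninNum t η n a f (z + tau t)
      = 1 * cexp (-Real.pi * I * (2 * (n + 2)) * (tau t + 2 * z)) * sklyaninNum t η n a f z := by
  have h2 := sCoeff_add_tau t η a (-(z + tau t) - n / 2 * η)
  rw [show -(z + tau t) - n / 2 * η + tau t = -z - n / 2 * η by ring] at h2
  have h2' : sCoeff t η a (-(z + tau t) - n / 2 * η)
      = cexp (Real.pi * I * 4 * (tau t + 2 * (-(z + tau t) - n / 2 * η)))
        * sCoeff t η a (-z - n / 2 * η) := by
    rw [h2, ← mul_assoc, ← Complex.exp_add]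
    ring_nf
    simp
  have e1 : cexp (-Real.pi * I * (2 * (n + 2)) * (tau t + 2 * z))
      = cexp (-Real.pi * I * 4 * (tau t + 2 * (z - n / 2 * η)))
        * cexp (-(4 * ((n : ℂ) / 2) * Real.pi * I * (2 * (z + η) + tau t))) := by
    rw [← Complex.exp_add]; ring_nf
  have e2 : cexp (-Real.pi * I * (2 * (n + 2)) * (tau t + 2 * z))
      = cexp (Real.pi * I * 4 * (tau t + 2 * (-(z + tau t) - n / 2 * η)))
        * cexp (-(4 * ((n : ℂ) / 2) * Real.pi * I * (2 * (z - η) + tau t))) := by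
    rw [← Complex.exp_add]; ring_nf
  rw [sklyaninNum, h2', add_sub_right_comm z, sCoeff_add_tau, add_right_comm z, hf.2.2.2,
    add_sub_right_comm z, hf.2.2.2, one_mul, sklyaninNum]
  linear_combination -(sCoeff t η a (z - n / 2 * η) * f (z + η)) * e1
    + sCoeff t η a (-z - n / 2 * η) * f (z - η) * e2

/-- An odd quasi-periodic function of even degree vanishes at half-lattice points: `z` and `-z`
differ by a period there, and the multiplier of that period is `1`. -/
lemma eq_zero_of_odd_of_quasiperiodic {N : ℂ → ℂ} {T : ℂ} (m : ℕ) (hodd : ∀ z, N (-z) = -N z)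
    (h1 : ∀ z, N (z + 1) = N z)
    (hT : ∀ z, N (z + T) = 1 * cexp (-Real.pi * I * (2 * m) * (T + 2 * z)) * N z)
    {z : ℂ} {a b : ℤ} (hz : 2 * z = a + b * T) : N z = 0 := by
  have e1 : N z = N (-z + b * T) := by
    have := apply_add_int (F := N) one_ne_zero (fun z => by rw [h1, one_mul]) a (-z + b * T)
    rw [one_zpow, one_mul] at this
    rw [← this]
    congr 1
    linear_combination hz
  have e2 : cexp (-Real.pi * I * (2 * m) * (b ^ 2 * T + 2 * b * -z)) = 1 := by
    refine Complex.exp_eq_one_iff.2 ⟨m * a * b, ?_⟩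
    push_cast
    linear_combination (2 * Real.pi * I * m * b) * hz
  rw [apply_add_int_mul (F := N) one_ne_zero hT, e2, hodd, one_zpow, one_mul, one_mul] at e1
  exact self_eq_neg.1 e1

lemma exists_th_one_one_two_mul_ne_zero {t : ℝ} (ht : 0 < t) :
    ∃ z, (fun z => th t 1 1 (2 * z)) z ≠ 0 := by
  obtain ⟨z, hz⟩ := exists_th_one_one_ne_zero ht
  exact ⟨z / 2, by simpa [mul_div_cancel₀] using hz⟩

lemma differentiable_th_two_mul {t : ℝ} (ht : 0 < t) :
    Differentiable ℂ fun z => th t 1 1 (2 * z) :=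
  (differentiable_th ht 1 1).comp (differentiable_id.const_mul 2)

lemma deriv_th_two_mul_ne_zero {t : ℝ} (ht : 0 < t) {z : ℂ} (hz : th t 1 1 (2 * z) = 0) :
    deriv (fun z => th t 1 1 (2 * z)) z ≠ 0 := by
  have h := (differentiable_th ht 1 1 (2 * z)).hasDerivAt.comp z
    ((hasDerivAt_id z).const_mul (2 : ℂ))
  have h' : deriv (fun z => th t 1 1 (2 * z)) z = deriv (th t 1 1) (2 * z) * (2 * 1) := h.deriv
  rw [h']
  exact mul_ne_zero (deriv_th_one_one_ne_zero ht hz) (by norm_num)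

/-- On the representation space the difference operator is an honest quotient: its values are
entire functions whose product with `θ₁₁(2z)` is the numerator. -/
theorem sklyaninOp_spec {t : ℝ} (ht : 0 < t) (η : ℝ) {n : ℕ} (a : Fin 4) {f : ℂ → ℂ}
    (hf : f ∈ thetaSpace t n) : Differentiable ℂ (sklyaninOp t η n a f) ∧
      ∀ z, sklyaninOp t η n a f z * th t 1 1 (2 * z) = sklyaninNum t η n a f z := by
  obtain ⟨G, hG, hGN⟩ := exists_entire_quotient (differentiable_sklyaninNum ht η n a hf.1)
    (differentiable_th_two_mul ht) (fun z hz => deriv_th_two_mul_ne_zero ht hz) (fun z hz => by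
      obtain ⟨p, q, hpq⟩ := th_one_one_eq_zero ht hz
      refine eq_zero_of_odd_of_quasiperiodic (n + 2) (sklyaninNum_neg a hf)
        (sklyaninNum_add_one a hf) (fun z => ?_) hpq
      rw [sklyaninNum_add_tau a hf]
      push_cast
      rfl)
  suffices h : sklyaninOp t η n a f = G by rw [h]; exact ⟨hG, hGN⟩
  funext z
  refine Tendsto.limUnder_eq ?_
  refine (hG.continuous.continuousAt.tendsto.mono_left nhdsWithin_le_nhds :
    Tendsto G (𝓝[≠] z) (𝓝 (G z))).congr' ?_
  have hne : ∀ᶠ w in 𝓝[≠] z, th t 1 1 (2 * w) ≠ 0 := by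
    by_cases hz : th t 1 1 (2 * z) = 0
    · have hd := (differentiable_th_two_mul ht z).hasDerivAt
      exact hd.eventually_ne (deriv_th_two_mul_ne_zero ht hz)
    · exact ((differentiable_th_two_mul ht).continuous.continuousAt.eventually_ne hz).filter_mono
        nhdsWithin_le_nhds
  filter_upwards [hne] with w hw
  rw [eq_div_iff hw]
  exact hGN w

theorem sklyaninOp_mem {t : ℝ} (ht : 0 < t) (η : ℝ) {n : ℕ} (a : Fin 4) {f : ℂ → ℂ}
    (hf : f ∈ thetaSpace t n) : sklyaninOp t η n a f ∈ thetaSpace t n := by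
  obtain ⟨hG, hGN⟩ := sklyaninOp_spec ht η a hf
  have hD := differentiable_th_two_mul ht
  have hne := exists_th_one_one_two_mul_ne_zero ht
  refine ⟨hG, fun z => ?_, fun z => ?_, fun z => ?_⟩
  · refine congrFun (eq_of_mul_eq_mul (f := fun z => sklyaninOp t η n a f (z + 1))
      (hG.comp (by fun_prop)) hG hD hne fun z => ?_) z
    have h1 := hGN (z + 1)
    rw [sklyaninNum_add_one a hf, ← hGN, mul_add, mul_one, ← one_add_one_eq_two, ← add_assoc,
      th_add_one, th_add_one, one_add_one_eq_two] at h1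
    linear_combination h1
  · refine congrFun (eq_of_mul_eq_mul (f := fun z => sklyaninOp t η n a f (-z))
      (hG.comp (by fun_prop)) hG hD hne fun z => ?_) z
    have h1 := hGN (-z)
    rw [sklyaninNum_neg a hf, ← hGN, mul_neg, th_one_one_neg] at h1
    linear_combination -h1
  · refine congrFun (eq_of_mul_eq_mul (f := fun z => sklyaninOp t η n a f (z + tau t))
      (g := fun z => cexp (-(4 * ((n : ℂ) / 2) * Real.pi * I * (2 * z + tau t)))
        * sklyaninOp t η n a f z)
      (hG.comp (by fun_prop)) (Differentiable.mul (by fun_prop) hG) hD hne fun z => ?_) z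
    have h1 := hGN (z + tau t)
    have e1 : cexp (-Real.pi * I * (2 * (n + 2)) * (tau t + 2 * z))
        = cexp (-Real.pi * I * 4 * (tau t + 2 * z))
          * cexp (-(4 * ((n : ℂ) / 2) * Real.pi * I * (2 * z + tau t))) := by
      rw [← Complex.exp_add]; ring_nf
    rw [sklyaninNum_add_tau a hf, ← hGN, mul_add, th_add_two_mul_tau, e1] at h1
    refine mul_left_cancel₀ (Complex.exp_ne_zero (-Real.pi * I * 4 * (tau t + 2 * z))) ?_
    linear_combination h1

/-- The denominators of the weights `W_a^L` do not vanish, since all zeros of theta functions with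
characteristics are half-lattice points and `τ` is purely imaginary. -/
lemma th_real_ne_zero {t : ℝ} (ht : 0 < t) {η : ℝ} (hη : ∀ m : ℤ, 2 * η ≠ m) (a b : ℕ) :
    th t a b η ≠ 0 := by
  intro h
  rw [th, theta_eq, mul_eq_zero, or_iff_right (Complex.exp_ne_zero _)] at h
  have h' : th t 1 1 (η + ((b : ℂ) - 1) / 2 + ((a : ℂ) - 1) / 2 * tau t) = 0 := by
    rw [th, theta_eq]
    refine mul_eq_zero_of_right _ ?_
    rw [← h]
    push_cast
    ring_nf
  obtain ⟨p, q, hpq⟩ := th_one_one_eq_zero ht h'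
  have hτ : (tau t).re = 0 := by rw [tau, div_ofReal_re]; simp
  apply hη (2 * p + 1 - b)
  have hre := congrArg Complex.re hpq
  have e1 : (((a : ℂ) - 1) / 2 * tau t).re = 0 := by
    rw [show ((a : ℂ) - 1) / 2 = ((((a : ℝ) - 1) / 2 : ℝ) : ℂ) by push_cast; ring, re_ofReal_mul,
      hτ, mul_zero]
  have e2 : ((q : ℂ) * tau t).re = 0 := by
    rw [show (q : ℂ) = ((q : ℝ) : ℂ) by push_cast; ring, re_ofReal_mul, hτ, mul_zero]
  have e3 : (((b : ℂ) - 1) / 2).re = ((b : ℝ) - 1) / 2 := by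
    rw [show ((b : ℂ) - 1) / 2 = ((((b : ℝ) - 1) / 2 : ℝ) : ℂ) by push_cast; ring, ofReal_re]
  rw [add_re, add_re, add_re, e1, e2, e3] at hre
  simp at hre
  push_cast
  linarith

/-- Each of the two terms of the `L`-operator has rank one as a `2 × 2` matrix. -/
theorem lOp_mul_th {t : ℝ} (ht : 0 < t) {η : ℝ} (hη : ∀ m : ℤ, 2 * η ≠ m) {n : ℕ} (lam : ℂ)
    (i j : Fin 2) {f : ℂ → ℂ} (hf : f ∈ thetaSpace t n) (z : ℂ) :
    lOp t η n lam i j f z * th t 1 1 (2 * z)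
      = (![half₀ t (lam / 2 - z + n / 2 * η), -half₁ t (lam / 2 - z + n / 2 * η)] : Fin 2 → ℂ) i
        * (![half₁ t (lam / 2 + z - n / 2 * η), half₀ t (lam / 2 + z - n / 2 * η)] : Fin 2 → ℂ) j
        * f (z + η)
      - (![half₀ t (lam / 2 + z + n / 2 * η), -half₁ t (lam / 2 + z + n / 2 * η)] : Fin 2 → ℂ) i
        * (![half₁ t (lam / 2 - z - n / 2 * η), half₀ t (lam / 2 - z - n / 2 * η)] : Fin 2 → ℂ) j
        * f (z - η) := by
  rw [← theta_sum_rank_one ht, ← theta_sum_rank_one ht, lOp, Finset.sum_apply, Finset.sum_mul,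
    Finset.sum_mul, Finset.sum_mul, ← Finset.sum_sub_distrib]
  refine Finset.sum_congr rfl fun a _ => ?_
  have hne := th_real_ne_zero ht hη (char₁ a) (char₂ a)
  rw [Pi.smul_apply, smul_eq_mul, mul_assoc, (sklyaninOp_spec ht η a hf).2, sklyaninNum, sCoeff,
    sCoeff, weightL,
    show lam / 2 + z - n / 2 * η + (lam / 2 - z + n / 2 * η) = lam by ring,
    show lam / 2 - z - n / 2 * η + (lam / 2 + z + n / 2 * η) = lam by ring,
    show lam / 2 + z - n / 2 * η - (lam / 2 - z + n / 2 * η) = 2 * (z - n / 2 * η) by ring,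
    show lam / 2 - z - n / 2 * η - (lam / 2 + z + n / 2 * η) = 2 * (-z - n / 2 * η) by ring]
  field_simp

/-! ### Intertwining vectors and strings of theta functions -/

noncomputable section

/-- `∏_{j<N} θ₀₀(x + 2 j η)`. -/
def thetaProd (t η : ℝ) (x : ℂ) (N : ℕ) : ℂ := ∏ j ∈ Finset.range N, th t 0 0 (x + 2 * j * η)

/-- `∏_{j<N} θ₀₀(z + x + 2jη) θ₀₀(-z + x + 2jη)`. By parity of `θ₀₀` the second factor is
`θ₀₀(z - x - 2jη)`. -/
def thetaString (t η : ℝ) (x : ℂ) (N : ℕ) (z : ℂ) : ℂ :=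
  thetaProd t η (z + x) N * thetaProd t η (-z + x) N

/-- The constant factor `a_{k,k'}` of the intertwining vector. -/
def phiCoeff (η : ℝ) (n : ℕ) (c : ℂ) (k k' : ℤ) : ℂ :=
  cexp (2 * Real.pi * I * ((n : ℂ) / 2) * (k + k') * η) * c ^ (k - k')

end

lemma thetaProd_succ (t η : ℝ) (x : ℂ) (N : ℕ) :
    thetaProd t η x (N + 1) = thetaProd t η x N * th t 0 0 (x + 2 * N * η) :=
  Finset.prod_range_succ _ _

lemma thetaProd_succ' (t η : ℝ) (x : ℂ) (N : ℕ) :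
    thetaProd t η x (N + 1) = th t 0 0 x * thetaProd t η (x + 2 * η) N := by
  rw [thetaProd, Finset.prod_range_succ', mul_comm, thetaProd]
  congr 1
  · simp
  · refine Finset.prod_congr rfl fun j _ => ?_
    push_cast
    ring_nf

lemma thetaString_neg (t η : ℝ) (x : ℂ) (N : ℕ) (z : ℂ) :
    thetaString t η x N (-z) = thetaString t η x N z := by
  rw [thetaString, thetaString, neg_neg, mul_comm]

lemma thetaString_succ (t η : ℝ) (x : ℂ) (N : ℕ) (z : ℂ) :
    thetaString t η x (N + 1) z = thetaString t η x N z
      * (th t 0 0 (z + (x + 2 * N * η)) * th t 0 0 (-z + (x + 2 * N * η))) := by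
  rw [thetaString, thetaProd_succ, thetaProd_succ, thetaString, ← add_assoc, ← add_assoc]
  ring

lemma thetaString_mem {t : ℝ} (ht : 0 < t) (η : ℝ) (x : ℂ) (N : ℕ) :
    thetaString t η x N ∈ thetaSpace t N := by
  induction N with
  | zero =>
    have : thetaString t η x 0 = fun _ => 1 := funext fun z => by simp [thetaString, thetaProd]
    rw [this]
    exact ⟨differentiable_const _, fun _ => rfl, fun _ => rfl, fun _ => by simp⟩
  | succ N ih =>
    obtain ⟨h1, h2, h3, h4⟩ := ih
    have hth := differentiable_th ht 0 0
    refine ⟨?_, fun z => ?_, thetaString_neg t η x (N + 1), fun z => ?_⟩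
    · rw [funext (thetaString_succ t η x N)]
      exact h1.mul ((hth.comp (by fun_prop)).mul (hth.comp (by fun_prop)))
    · rw [thetaString_succ, thetaString_succ, h2, ← th_zero_zero_neg t (-(z + 1) + _),
        ← th_zero_zero_neg t (-z + _), neg_add (-(z + 1)), neg_neg, neg_add (-z), neg_neg,
        add_right_comm z 1, add_right_comm z 1, th_add_one, th_add_one]
      ring
    · have e : cexp (-(4 * (((N + 1 : ℕ) : ℂ) / 2) * Real.pi * I * (2 * z + tau t)))
          = cexp (-(4 * ((N : ℂ) / 2) * Real.pi * I * (2 * z + tau t)))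
            * (cexp (-Real.pi * I * (tau t + 2 * (z + (x + 2 * N * η))))
            * cexp (-Real.pi * I * (tau t + 2 * (z + -(x + 2 * N * η))))) := by
        rw [← Complex.exp_add, ← Complex.exp_add]; push_cast; ring_nf
      rw [thetaString_succ, thetaString_succ, h4, ← th_zero_zero_neg t (-(z + tau t) + _),
        ← th_zero_zero_neg t (-z + _), neg_add (-(z + tau t)), neg_neg, neg_add (-z), neg_neg,
        add_right_comm z (tau t), add_right_comm z (tau t), th_add_tau, th_add_tau, e]
      ring

lemma mul_mem_thetaSpace {t : ℝ} {m n : ℕ} {f g : ℂ → ℂ} (hf : f ∈ thetaSpace t m)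
    (hg : g ∈ thetaSpace t n) : (fun z => f z * g z) ∈ thetaSpace t (m + n) := by
  refine ⟨hf.1.mul hg.1, fun z => ?_, fun z => ?_, fun z => ?_⟩
  · dsimp only
    rw [hf.2.1, hg.2.1]
  · dsimp only
    rw [hf.2.2.1, hg.2.2.1]
  · have e : cexp (-(4 * (((m + n : ℕ) : ℂ) / 2) * Real.pi * I * (2 * z + tau t)))
        = cexp (-(4 * ((m : ℂ) / 2) * Real.pi * I * (2 * z + tau t)))
          * cexp (-(4 * ((n : ℂ) / 2) * Real.pi * I * (2 * z + tau t))) := by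
      rw [← Complex.exp_add]; push_cast; ring_nf
    dsimp only
    rw [hf.2.2.2, hg.2.2.2, e]
    ring

lemma prod_Icc_eq_thetaString (t η : ℝ) {x u v l : ℂ} (N : ℕ) (z : ℂ)
    (h : x = u + v + (l + 1) * η) :
    (∏ j ∈ Finset.Icc 1 N, th t 0 0 (z + u + v + (l + 2 * (j : ℂ) - 1) * η)
        * th t 0 0 (z - u - v - (l + 2 * (j : ℂ) - 1) * η)) = thetaString t η x N z := by
  induction N with
  | zero => simp [thetaString, thetaProd]
  | succ N ih =>
    rw [Finset.prod_Icc_succ_top (by omega), ih, thetaString_succ,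
      ← th_zero_zero_neg t (-z + _), h]
    push_cast
    ring_nf

/-- An intertwining vector is a product of two strings, of lengths `A = ℓ + (k - k')/2` and
`B = ℓ - (k - k')/2`. -/
lemma phi_eq {t η : ℝ} {n : ℕ} {sp sm c mu : ℂ} {k k' : ℤ} {A B : ℕ} {x y : ℂ} (hn : n = A + B)
    (hk : k - k' = A - B) (hx : x = (sp - mu) / 2 + tau t / 4 + (k' - (n : ℂ) / 2 + 1) * η)
    (hy : y = (sm + mu) / 2 + tau t / 4 + (k - (n : ℂ) / 2 + 1) * η) :
    phi t η n sp sm c mu k k'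
      = fun z => phiCoeff η n c k k' * (thetaString t η x A z * thetaString t η y B z) := by
  funext z
  rw [phi, show (((n : ℤ) + (k - k')) / 2).toNat = A by omega,
    show (((n : ℤ) - (k - k')) / 2).toNat = B by omega, prod_Icc_eq_thetaString t η A z hx,
    prod_Icc_eq_thetaString t η B z hy, phiCoeff]
  ring

lemma phi_mem {t : ℝ} (ht : 0 < t) {η : ℝ} {n : ℕ} {sp sm c mu : ℂ} {k k' : ℤ}
    (h : Admissible n k k') : phi t η n sp sm c mu k k' ∈ thetaSpace t n := by
  obtain ⟨A, hA, hk⟩ := h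
  obtain ⟨B, rfl⟩ := Nat.exists_eq_add_of_le hA
  rw [phi_eq (A := A) (B := B) rfl (by push_cast at hk; omega) rfl rfl]
  exact (thetaSpace t (A + B)).smul_mem (phiCoeff η (A + B) c k k')
    (mul_mem_thetaSpace (thetaString_mem ht η _ A) (thetaString_mem ht η _ B))

/-- No admissibility is needed here, so that this covers also the vectors which occur with
coefficient zero. -/
lemma differentiable_phi {t : ℝ} (ht : 0 < t) (η : ℝ) (n : ℕ) (sp sm c mu : ℂ) (k k' : ℤ) :
    Differentiable ℂ (phi t η n sp sm c mu k k') := by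
  have hth := differentiable_th ht 0 0
  have h (u v : ℂ) (q : ℕ → ℂ) (s : Finset ℕ) :
      Differentiable ℂ fun z => ∏ j ∈ s, th t 0 0 (z + u + v + q j) * th t 0 0 (z - u - v - q j) :=
    Differentiable.fun_finsetProd fun j _ => (hth.comp (by fun_prop)).mul (hth.comp (by fun_prop))
  exact ((differentiable_const _).mul (h _ _ _ _)).mul (h _ _ _ _)

lemma th_mul_thetaProd (t η : ℝ) (x : ℂ) (N : ℕ) :
    th t 0 0 x * thetaProd t η (x + 2 * η) N = thetaProd t η x N * th t 0 0 (x + 2 * N * η) := by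
  rw [← thetaProd_succ', thetaProd_succ]

lemma thetaString_shift (t η : ℝ) (x : ℂ) (N : ℕ) (z : ℂ) :
    thetaString t η (x + η) N (z + η)
      = thetaProd t η (z + x + 2 * η) N * thetaProd t η (-z + x) N := by
  rw [thetaString]
  ring_nf

/-- One factor at the left end restores a translated string to the string starting at `x`. -/
lemma thetaString_shift_left (t η : ℝ) (x : ℂ) (N : ℕ) (z : ℂ) :
    th t 0 0 (z + x) * thetaString t η (x + η) N (z + η)
      = thetaString t η x N z * th t 0 0 (z + (x + 2 * N * η)) := by
  rw [thetaString_shift, thetaString, ← mul_assoc, th_mul_thetaProd, ← add_assoc]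
  ring

/-- One factor at the right end turns a translated string into the string starting at `x + 2η`. -/
lemma thetaString_shift_right (t η : ℝ) (x : ℂ) (N : ℕ) (z : ℂ) :
    th t 0 0 (-z + (x + 2 * N * η)) * thetaString t η (x + η) N (z + η)
      = thetaString t η (x + 2 * η) N z * th t 0 0 (-z + x) := by
  have := th_mul_thetaProd t η (-z + x) N
  rw [thetaString_shift, thetaString, ← add_assoc, ← add_assoc, ← add_assoc]
  linear_combination -thetaProd t η (z + x + 2 * η) N * this

/-- Factors at both ends lengthen the translated string by one. -/
lemma thetaString_shift_up (t η : ℝ) (x : ℂ) (N : ℕ) (z : ℂ) :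
    th t 0 0 (z + x) * th t 0 0 (-z + (x + 2 * N * η)) * thetaString t η (x + η) N (z + η)
      = thetaString t η x (N + 1) z := by
  rw [thetaString_shift, thetaString, thetaProd_succ', thetaProd_succ, ← add_assoc]
  ring

/-- A translated string contains the string without its two ends. -/
lemma thetaString_shift_down (t η : ℝ) (x : ℂ) (N : ℕ) (z : ℂ) :
    thetaString t η (x + η) (N + 1) (z + η)
      = thetaString t η (x + 2 * η) N z
        * (th t 0 0 (z + (x + 2 * (N + 1) * η)) * th t 0 0 (-z + x)) := by
  rw [thetaString_shift, thetaString, thetaProd_succ, thetaProd_succ']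
  ring_nf

section core

variable {t : ℝ} (ht : 0 < t) (η : ℝ) (c d lam : ℂ) (A B : ℕ) (z : ℂ)
include ht

/-- The theta function identity behind the diagonal entry `α`. -/
lemma antisymm_alpha :
    th t 0 0 (-z + (d + (A + B) * η + lam)) * th t 0 0 (z + d)
        * (th t 0 0 (z + c) * th t 0 0 (-z + (c + (A + B) * η - lam)))
        * (thetaString t η (c + η) A (z + η) * thetaString t η (d + η) B (z + η))
      - th t 0 0 (z + (d + (A + B) * η + lam)) * th t 0 0 (-z + d)
        * (th t 0 0 (-z + c) * th t 0 0 (z + (c + (A + B) * η - lam)))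
        * (thetaString t η (c + η) A (-z + η) * thetaString t η (d + η) B (-z + η))
      = thetaString t η c A z * thetaString t η d B z *
        (th t 1 1 (2 * z) * th t 1 1 (c + d + 2 * (A + B) * η)
          * (th t 1 1 (c - d + (A - B) * η - lam) * th t 1 1 (lam + (A - B) * η))) := by
  have h1 := thetaString_shift_left t η c A z
  have h2 := thetaString_shift_left t η d B z
  have h1' := thetaString_shift_left t η c A (-z)
  have h2' := thetaString_shift_left t η d B (-z)
  rw [thetaString_neg] at h1' h2'
  have key := th_antisymm ht (c + 2 * A * η) (d + 2 * B * η) (d + (A + B) * η + lam)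
    (c + (A + B) * η - lam) z (by ring)
  rw [show c + 2 * A * η + (d + 2 * B * η) = c + d + 2 * (A + B) * η by ring,
    show c + 2 * A * η - (d + (A + B) * η + lam) = c - d + (A - B) * η - lam by ring,
    show c + 2 * A * η - (c + (A + B) * η - lam) = lam + (A - B) * η by ring] at key
  rw [← key]
  linear_combination (th t 0 0 (-z + (d + (A + B) * η + lam))
      * th t 0 0 (-z + (c + (A + B) * η - lam))) *
      (th t 0 0 (z + d) * thetaString t η (d + η) B (z + η) * h1
        + thetaString t η c A z * th t 0 0 (z + (c + 2 * A * η)) * h2)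
    - (th t 0 0 (z + (d + (A + B) * η + lam)) * th t 0 0 (z + (c + (A + B) * η - lam))) *
      (th t 0 0 (-z + d) * thetaString t η (d + η) B (-z + η) * h1'
        + thetaString t η c A z * th t 0 0 (-z + (c + 2 * A * η)) * h2')

/-- The theta function identity behind the diagonal entry `δ`. -/
lemma antisymm_delta :
    th t 0 0 (-z + (c + 2 * A * η)) * th t 0 0 (z + (c + (A - B) * η - lam))
        * (th t 0 0 (z + (d + (B - A) * η + lam)) * th t 0 0 (-z + (d + 2 * B * η)))
        * (thetaString t η (c + η) A (z + η) * thetaString t η (d + η) B (z + η))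
      - th t 0 0 (z + (c + 2 * A * η)) * th t 0 0 (-z + (c + (A - B) * η - lam))
        * (th t 0 0 (-z + (d + (B - A) * η + lam)) * th t 0 0 (z + (d + 2 * B * η)))
        * (thetaString t η (c + η) A (-z + η) * thetaString t η (d + η) B (-z + η))
      = thetaString t η (c + 2 * η) A z * thetaString t η (d + 2 * η) B z *
        (th t 1 1 (2 * z) * th t 1 1 (c + d)
          * (th t 1 1 (-(lam - (A - B) * η)) * th t 1 1 (c - d + (A - B) * η - lam))) := by
  have h1 := thetaString_shift_right t η c A z
  have h2 := thetaString_shift_right t η d B z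
  have h1' := thetaString_shift_right t η c A (-z)
  have h2' := thetaString_shift_right t η d B (-z)
  rw [thetaString_neg, neg_neg] at h1' h2'
  have key := th_antisymm ht (c + (A - B) * η - lam) (d + (B - A) * η + lam) c d z (by ring)
  rw [show c + (A - B) * η - lam + (d + (B - A) * η + lam) = c + d by ring,
    show c + (A - B) * η - lam - c = -(lam - (A - B) * η) by ring,
    show c + (A - B) * η - lam - d = c - d + (A - B) * η - lam by ring] at key
  rw [← key]
  linear_combination (th t 0 0 (z + (c + (A - B) * η - lam))
      * th t 0 0 (z + (d + (B - A) * η + lam))) *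
      (th t 0 0 (-z + (d + 2 * B * η)) * thetaString t η (d + η) B (z + η) * h1
        + thetaString t η (c + 2 * η) A z * th t 0 0 (-z + c) * h2)
    - (th t 0 0 (-z + (c + (A - B) * η - lam)) * th t 0 0 (-z + (d + (B - A) * η + lam))) *
      (th t 0 0 (z + (d + 2 * B * η)) * thetaString t η (d + η) B (-z + η) * h1'
        + thetaString t η (c + 2 * η) A z * th t 0 0 (z + c) * h2')

/-- The theta function identity behind the off-diagonal entry `β` when `k - k' ≠ -2ℓ`. -/
lemma antisymm_beta :
    th t 0 0 (-z + (d + ((A + 1 : ℕ) + B) * η + lam)) * th t 0 0 (z + d)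
        * (th t 0 0 (z + (d + (B - (A + 1 : ℕ)) * η + lam)) * th t 0 0 (-z + (d + 2 * B * η)))
        * (thetaString t η (c + η) (A + 1) (z + η) * thetaString t η (d + η) B (z + η))
      - th t 0 0 (z + (d + ((A + 1 : ℕ) + B) * η + lam)) * th t 0 0 (-z + d)
        * (th t 0 0 (-z + (d + (B - (A + 1 : ℕ)) * η + lam)) * th t 0 0 (z + (d + 2 * B * η)))
        * (thetaString t η (c + η) (A + 1) (-z + η) * thetaString t η (d + η) B (-z + η))
      = thetaString t η (c + 2 * η) A z * thetaString t η d (B + 1) z *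
        (th t 1 1 (2 * z) * th t 1 1 (c + d + ((A + 1 : ℕ) + B) * η + lam)
          * (th t 1 1 (2 * (A + 1 : ℕ) * η)
            * th t 1 1 (c - d + ((A + 1 : ℕ) - B) * η - lam))) := by
  have h1 := thetaString_shift_down t η c A z
  have h2 := thetaString_shift_up t η d B z
  have h1' := thetaString_shift_down t η c A (-z)
  have h2' := thetaString_shift_up t η d B (-z)
  rw [thetaString_neg, neg_neg] at h1' h2'
  push_cast
  have key := th_antisymm ht (c + 2 * (A + 1) * η) (d + (B - (A + 1)) * η + lam) c
    (d + ((A + 1) + B) * η + lam) z (by ring)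
  rw [show c + 2 * (A + 1) * η + (d + (B - (A + 1)) * η + lam)
      = c + d + ((A + 1) + B) * η + lam by ring,
    show c + 2 * (A + 1) * η - c = 2 * (A + 1) * η by ring,
    show c + 2 * (A + 1) * η - (d + ((A + 1) + B) * η + lam)
      = c - d + ((A + 1) - B) * η - lam by ring] at key
  rw [← key, h1, h1']
  linear_combination thetaString t η (c + 2 * η) A z * (th t 0 0 (z + (c + 2 * (A + 1) * η))
      * th t 0 0 (-z + c) * th t 0 0 (-z + (d + ((A + 1) + B) * η + lam))
      * th t 0 0 (z + (d + (B - (A + 1)) * η + lam)) * h2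
      - th t 0 0 (-z + (c + 2 * (A + 1) * η)) * th t 0 0 (z + c)
      * th t 0 0 (z + (d + ((A + 1) + B) * η + lam))
      * th t 0 0 (-z + (d + (B - (A + 1)) * η + lam)) * h2')

omit ht in
/-- For `k - k' = -2ℓ` the expression behind `β` is even in `z`, so its antisymmetrization
vanishes. -/
lemma antisymm_beta_zero :
    th t 0 0 (-z + (d + ((0 : ℕ) + B) * η + lam)) * th t 0 0 (z + d)
        * (th t 0 0 (z + (d + (B - (0 : ℕ)) * η + lam)) * th t 0 0 (-z + (d + 2 * B * η)))
        * (thetaString t η (c + η) 0 (z + η) * thetaString t η (d + η) B (z + η))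
      - th t 0 0 (z + (d + ((0 : ℕ) + B) * η + lam)) * th t 0 0 (-z + d)
        * (th t 0 0 (-z + (d + (B - (0 : ℕ)) * η + lam)) * th t 0 0 (z + (d + 2 * B * η)))
        * (thetaString t η (c + η) 0 (-z + η) * thetaString t η (d + η) B (-z + η)) = 0 := by
  have h2 := thetaString_shift_up t η d B z
  have h2' := thetaString_shift_up t η d B (-z)
  rw [thetaString_neg, neg_neg] at h2'
  have e (u : ℂ) : thetaString t η (c + η) 0 u = 1 := by simp [thetaString, thetaProd]
  simp only [e, Nat.cast_zero, zero_add, sub_zero, one_mul]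
  linear_combination th t 0 0 (-z + (d + B * η + lam)) * th t 0 0 (z + (d + B * η + lam))
    * (h2 - h2')

/-- The theta function identity behind the off-diagonal entry `γ` when `k - k' ≠ 2ℓ`. -/
lemma antisymm_gamma :
    th t 0 0 (-z + (c + 2 * A * η)) * th t 0 0 (z + (c + (A - (B + 1 : ℕ)) * η - lam))
        * (th t 0 0 (z + c) * th t 0 0 (-z + (c + (A + (B + 1 : ℕ)) * η - lam)))
        * (thetaString t η (c + η) A (z + η) * thetaString t η (d + η) (B + 1) (z + η))
      - th t 0 0 (z + (c + 2 * A * η)) * th t 0 0 (-z + (c + (A - (B + 1 : ℕ)) * η - lam))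
        * (th t 0 0 (-z + c) * th t 0 0 (z + (c + (A + (B + 1 : ℕ)) * η - lam)))
        * (thetaString t η (c + η) A (-z + η) * thetaString t η (d + η) (B + 1) (-z + η))
      = thetaString t η c (A + 1) z * thetaString t η (d + 2 * η) B z *
        (th t 1 1 (2 * z) * th t 1 1 (c + d + (A + (B + 1 : ℕ)) * η - lam)
          * (th t 1 1 (-2 * (B + 1 : ℕ) * η)
            * th t 1 1 (c - d + (A - (B + 1 : ℕ)) * η - lam))) := by
  have h1 := thetaString_shift_down t η d B z
  have h2 := thetaString_shift_up t η c A z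
  have h1' := thetaString_shift_down t η d B (-z)
  have h2' := thetaString_shift_up t η c A (-z)
  rw [thetaString_neg, neg_neg] at h1' h2'
  push_cast
  have key := th_antisymm ht (c + (A - (B + 1)) * η - lam) (d + 2 * (B + 1) * η)
    (c + (A + (B + 1)) * η - lam) d z (by ring)
  rw [show c + (A - (B + 1)) * η - lam + (d + 2 * (B + 1) * η)
      = c + d + (A + (B + 1)) * η - lam by ring,
    show c + (A - (B + 1)) * η - lam - (c + (A + (B + 1)) * η - lam)
      = -2 * (B + 1) * η by ring,
    show c + (A - (B + 1)) * η - lam - d = c - d + (A - (B + 1)) * η - lam by ring] at key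
  rw [← key, h1, h1']
  linear_combination thetaString t η (d + 2 * η) B z * (th t 0 0 (z + (d + 2 * (B + 1) * η))
      * th t 0 0 (-z + d) * th t 0 0 (z + (c + (A - (B + 1)) * η - lam))
      * th t 0 0 (-z + (c + (A + (B + 1)) * η - lam)) * h2
      - th t 0 0 (-z + (d + 2 * (B + 1) * η)) * th t 0 0 (z + d)
      * th t 0 0 (-z + (c + (A - (B + 1)) * η - lam))
      * th t 0 0 (z + (c + (A + (B + 1)) * η - lam)) * h2')

omit ht in
/-- For `k - k' = 2ℓ` the expression behind `γ` is even in `z`, so its antisymmetrization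
vanishes. -/
lemma antisymm_gamma_zero :
    th t 0 0 (-z + (c + 2 * A * η)) * th t 0 0 (z + (c + (A - (0 : ℕ)) * η - lam))
        * (th t 0 0 (z + c) * th t 0 0 (-z + (c + (A + (0 : ℕ)) * η - lam)))
        * (thetaString t η (c + η) A (z + η) * thetaString t η (d + η) 0 (z + η))
      - th t 0 0 (z + (c + 2 * A * η)) * th t 0 0 (-z + (c + (A - (0 : ℕ)) * η - lam))
        * (th t 0 0 (-z + c) * th t 0 0 (z + (c + (A + (0 : ℕ)) * η - lam)))
        * (thetaString t η (c + η) A (-z + η) * thetaString t η (d + η) 0 (-z + η)) = 0 := by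
  have h2 := thetaString_shift_up t η c A z
  have h2' := thetaString_shift_up t η c A (-z)
  rw [thetaString_neg, neg_neg] at h2'
  have e (u : ℂ) : thetaString t η (d + η) 0 u = 1 := by simp [thetaString, thetaProd]
  simp only [e, Nat.cast_zero, add_zero, sub_zero, mul_one]
  linear_combination th t 0 0 (-z + (c + A * η - lam)) * th t 0 0 (z + (c + A * η - lam))
    * (h2 - h2')

end core

/-! ### The gauge transformation -/

section gauge

variable {t : ℝ} (ht : 0 < t) (η : ℝ) (sp sm lam : ℂ) (k : ℤ)
include ht

/-- The columns of the gauge matrix are multiples of `v(x_k/2 + τ/4)` and `v(y_k/2 + τ/4)`. -/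
lemma gaugeM_eq : gaugeM t η sp sm lam k =
    !![gaugeConst t * cexp (Real.pi * I * (sp - lam + 2 * k * η))
          * half₁ t ((sp - lam + 2 * k * η) / 2 + tau t / 4),
        gaugeConst t * cexp (Real.pi * I * (sm + lam + 2 * k * η))
          * half₁ t ((sm + lam + 2 * k * η) / 2 + tau t / 4) * (th t 1 1 (wPar t η sp sm k))⁻¹;
      gaugeConst t * cexp (Real.pi * I * (sp - lam + 2 * k * η))
          * half₀ t ((sp - lam + 2 * k * η) / 2 + tau t / 4),
        gaugeConst t * cexp (Real.pi * I * (sm + lam + 2 * k * η))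
          * half₀ t ((sm + lam + 2 * k * η) / 2 + tau t / 4) * (th t 1 1 (wPar t η sp sm k))⁻¹] := by
  simp only [← theta_zero_one_modular ht, ← theta_one_one_modular ht, gaugeM,
    Matrix.mul_fin_two]
  simp

/-- The normalization by `θ₁₁(w_k)` makes the determinant independent of `k`. -/
lemma gaugeM_det (hw : th t 1 1 (wPar t η sp sm k) ≠ 0) : (gaugeM t η sp sm lam k).det
    = -2 * gaugeConst t ^ 2 * th t 1 1 ((sp - sm) / 2 - lam) := by
  have h := two_mul_th_one_one_mul ht ((sp - lam + 2 * k * η) / 2 + tau t / 4)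
    ((sm + lam + 2 * k * η) / 2 + tau t / 4)
  rw [show (sp - lam + 2 * k * η) / 2 + tau t / 4 + ((sm + lam + 2 * k * η) / 2 + tau t / 4)
      = wPar t η sp sm k + tau t by rw [wPar]; ring,
    show (sp - lam + 2 * k * η) / 2 + tau t / 4 - ((sm + lam + 2 * k * η) / 2 + tau t / 4)
      = (sp - sm) / 2 - lam by ring, th_add_tau] at h
  have e : cexp (Real.pi * I * (sp - lam + 2 * k * η)) * cexp (Real.pi * I * (sm + lam + 2 * k * η))
      * cexp (-Real.pi * I * (tau t + 2 * wPar t η sp sm k)) = 1 := by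
    rw [← Complex.exp_add, ← Complex.exp_add, ← Complex.exp_zero, wPar]
    ring_nf
  rw [gaugeM_eq ht, Matrix.det_fin_two_of]
  generalize (sp - lam + 2 * k * η) / 2 + tau t / 4 = X at h ⊢
  generalize (sm + lam + 2 * k * η) / 2 + tau t / 4 = Y at h ⊢
  generalize th t 1 1 ((sp - sm) / 2 - lam) = Δ at h ⊢
  field_simp
  linear_combination -gaugeConst t ^ 2 * cexp (Real.pi * I * (sp - lam + 2 * k * η))
    * cexp (Real.pi * I * (sm + lam + 2 * k * η)) * h
    - 2 * gaugeConst t ^ 2 * th t 1 1 (wPar t η sp sm k) * Δ * e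

/-- The rows of `M_k⁻¹`, paired with the column vector of the rank-one `L`-operator, give products
of two theta functions; this is the first row. -/
lemma gaugeM_inv_row_zero (hw : th t 1 1 (wPar t η sp sm k) ≠ 0)
    (hΔ : th t 1 1 ((sp - sm) / 2 - lam) ≠ 0) (m : ℂ) :
    ∑ p : Fin 2, (gaugeM t η sp sm lam k)⁻¹ 0 p * (![half₀ t m, -half₁ t m] : Fin 2 → ℂ) p
      = -cexp (Real.pi * I * (sm + lam + 2 * k * η)) / (gaugeConst t
          * th t 1 1 ((sp - sm) / 2 - lam) * th t 1 1 (wPar t η sp sm k))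
        * (th t 0 0 ((sm + lam + 2 * k * η) / 2 + tau t / 4 + m)
          * th t 0 0 ((sm + lam + 2 * k * η) / 2 + tau t / 4 - m)) := by
  have hκ := gaugeConst_ne_zero ht
  have h := two_mul_th_zero_zero_mul ht ((sm + lam + 2 * k * η) / 2 + tau t / 4) m
  rw [Matrix.inv_def, gaugeM_det ht η sp sm lam k hw, Ring.inverse_eq_inv', gaugeM_eq ht,
    Matrix.adjugate_fin_two_of]
  simp only [Fin.sum_univ_two, Matrix.smul_apply, Matrix.of_apply, Matrix.cons_val_zero,
    Matrix.cons_val_one, Matrix.cons_val', Matrix.cons_val_fin_one, smul_eq_mul]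
  generalize (sm + lam + 2 * k * η) / 2 + tau t / 4 = Y at h ⊢
  generalize th t 1 1 ((sp - sm) / 2 - lam) = Δ at hΔ ⊢
  field_simp
  linear_combination h

lemma gaugeM_inv_row_one (hw : th t 1 1 (wPar t η sp sm k) ≠ 0)
    (hΔ : th t 1 1 ((sp - sm) / 2 - lam) ≠ 0) (m : ℂ) :
    ∑ p : Fin 2, (gaugeM t η sp sm lam k)⁻¹ 1 p * (![half₀ t m, -half₁ t m] : Fin 2 → ℂ) p
      = cexp (Real.pi * I * (sp - lam + 2 * k * η)) / (gaugeConst t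
          * th t 1 1 ((sp - sm) / 2 - lam))
        * (th t 0 0 ((sp - lam + 2 * k * η) / 2 + tau t / 4 + m)
          * th t 0 0 ((sp - lam + 2 * k * η) / 2 + tau t / 4 - m)) := by
  have hκ := gaugeConst_ne_zero ht
  have h := two_mul_th_zero_zero_mul ht ((sp - lam + 2 * k * η) / 2 + tau t / 4) m
  rw [Matrix.inv_def, gaugeM_det ht η sp sm lam k hw, Ring.inverse_eq_inv', gaugeM_eq ht,
    Matrix.adjugate_fin_two_of]
  simp only [Fin.sum_univ_two, Matrix.smul_apply, Matrix.of_apply, Matrix.cons_val_zero,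
    Matrix.cons_val_one, Matrix.cons_val', Matrix.cons_val_fin_one, smul_eq_mul]
  generalize (sp - lam + 2 * k * η) / 2 + tau t / 4 = X at h ⊢
  generalize th t 1 1 ((sp - sm) / 2 - lam) = Δ at hΔ ⊢
  field_simp
  linear_combination -h

/-- The columns of `M_{k'}`, paired with the row vector of the rank-one `L`-operator, give
products of two theta functions; this is the first column. -/
lemma gaugeM_col_zero (p : ℂ) :
    ∑ q : Fin 2, (![half₁ t p, half₀ t p] : Fin 2 → ℂ) q * gaugeM t η sp sm lam k q 0
      = 2 * gaugeConst t * cexp (Real.pi * I * (sp - lam + 2 * k * η))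
        * (th t 0 0 ((sp - lam + 2 * k * η) / 2 + tau t / 4 + p)
          * th t 0 0 ((sp - lam + 2 * k * η) / 2 + tau t / 4 - p)) := by
  have h := two_mul_th_zero_zero_mul ht ((sp - lam + 2 * k * η) / 2 + tau t / 4) p
  rw [gaugeM_eq ht]
  simp only [Fin.sum_univ_two, Matrix.of_apply, Matrix.cons_val_zero,
    Matrix.cons_val_one, Matrix.cons_val', Matrix.cons_val_fin_one]
  linear_combination -gaugeConst t * cexp (Real.pi * I * (sp - lam + 2 * k * η)) * h

lemma gaugeM_col_one (p : ℂ) :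
    ∑ q : Fin 2, (![half₁ t p, half₀ t p] : Fin 2 → ℂ) q * gaugeM t η sp sm lam k q 1
      = 2 * gaugeConst t * cexp (Real.pi * I * (sm + lam + 2 * k * η))
          / th t 1 1 (wPar t η sp sm k)
        * (th t 0 0 ((sm + lam + 2 * k * η) / 2 + tau t / 4 + p)
          * th t 0 0 ((sm + lam + 2 * k * η) / 2 + tau t / 4 - p)) := by
  have h := two_mul_th_zero_zero_mul ht ((sm + lam + 2 * k * η) / 2 + tau t / 4) p
  rw [gaugeM_eq ht]
  simp only [Fin.sum_univ_two, Matrix.of_apply, Matrix.cons_val_zero,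
    Matrix.cons_val_one, Matrix.cons_val', Matrix.cons_val_fin_one]
  generalize (sm + lam + 2 * k * η) / 2 + tau t / 4 = Y at h ⊢
  rw [div_eq_mul_inv]
  linear_combination -gaugeConst t * cexp (Real.pi * I * (sm + lam + 2 * k * η))
    * (th t 1 1 (wPar t η sp sm k))⁻¹ * h

end gauge

/-- An entry of `M_k⁻¹ L M_{k'}` applied to `f` is the antisymmetrization in `z` of a product `F`
of four theta functions and `f(z + η)`, divided by `θ₁₁(2z)`. It is computed by comparing both
sides after multiplication by `θ₁₁(2z)`. -/
theorem twistedL_eq_smul {t : ℝ} (ht : 0 < t) {η : ℝ} (hη : ∀ m : ℤ, 2 * η ≠ m) {n : ℕ}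
    {sp sm lam : ℂ} {k k' : ℤ} {i j : Fin 2} {f : ℂ → ℂ} (hf : f ∈ thetaSpace t n)
    {r s R S : ℂ}
    (hr : ∀ m, ∑ p : Fin 2, (gaugeM t η sp sm lam k)⁻¹ i p * (![half₀ t m, -half₁ t m] : Fin 2 → ℂ) p
      = r * (th t 0 0 (R + m) * th t 0 0 (R - m)))
    (hs : ∀ p, ∑ q : Fin 2, (![half₁ t p, half₀ t p] : Fin 2 → ℂ) q * gaugeM t η sp sm lam k' q j
      = s * (th t 0 0 (S + p) * th t 0 0 (S - p)))
    {F : ℂ → ℂ}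
    (hF : ∀ z, th t 0 0 (R + (lam / 2 - z + n / 2 * η)) * th t 0 0 (R - (lam / 2 - z + n / 2 * η))
      * (th t 0 0 (S + (lam / 2 + z - n / 2 * η)) * th t 0 0 (S - (lam / 2 + z - n / 2 * η)))
      * f (z + η) = F z)
    {W : ℂ} {ψ : ℂ → ℂ} (hψ : Differentiable ℂ ψ)
    (H : ∀ z, r * s * (F z - F (-z)) = W * ψ z * th t 1 1 (2 * z)) :
    twistedL t η n sp sm lam k k' i j f = W • ψ := by
  refine eq_of_mul_eq_mul ?_ (hψ.const_smul W) (differentiable_th_two_mul ht)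
    (exists_th_one_one_two_mul_ne_zero ht) fun z => ?_
  · refine Differentiable.sum fun p _ => Differentiable.sum fun q _ =>
      Differentiable.const_smul ?_ _
    exact Differentiable.sum fun a _ => (sklyaninOp_spec ht η a hf).1.const_smul _
  have hneg : f (-z + η) = f (z - η) := by rw [← hf.2.2.1]; ring_nf
  have key : twistedL t η n sp sm lam k k' i j f z * th t 1 1 (2 * z)
      = (∑ p : Fin 2, (gaugeM t η sp sm lam k)⁻¹ i p
          * (![half₀ t (lam / 2 - z + n / 2 * η), -half₁ t (lam / 2 - z + n / 2 * η)] : Fin 2 → ℂ) p)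
        * (∑ q : Fin 2, (![half₁ t (lam / 2 + z - n / 2 * η), half₀ t (lam / 2 + z - n / 2 * η)]
            : Fin 2 → ℂ) q * gaugeM t η sp sm lam k' q j) * f (z + η)
      - (∑ p : Fin 2, (gaugeM t η sp sm lam k)⁻¹ i p
          * (![half₀ t (lam / 2 + z + n / 2 * η), -half₁ t (lam / 2 + z + n / 2 * η)] : Fin 2 → ℂ) p)
        * (∑ q : Fin 2, (![half₁ t (lam / 2 - z - n / 2 * η), half₀ t (lam / 2 - z - n / 2 * η)]
            : Fin 2 → ℂ) q * gaugeM t η sp sm lam k' q j) * f (z - η) := by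
    rw [Finset.sum_mul_sum, Finset.sum_mul_sum, Finset.sum_mul, Finset.sum_mul,
      ← Finset.sum_sub_distrib, twistedL, Finset.sum_apply, Finset.sum_mul]
    refine Finset.sum_congr rfl fun p _ => ?_
    rw [Finset.sum_mul, Finset.sum_mul, ← Finset.sum_sub_distrib, Finset.sum_apply,
      Finset.sum_mul]
    refine Finset.sum_congr rfl fun q _ => ?_
    rw [Pi.smul_apply, smul_eq_mul, mul_assoc, lOp_mul_th ht hη lam p q hf]
    ring
  have h1 := hF z
  have h2 := hF (-z)
  rw [sub_neg_eq_add, ← sub_eq_add_neg, hneg] at h2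
  rw [key, hr, hs, hr, hs, Pi.smul_apply, smul_eq_mul, ← H]
  linear_combination r * s * (h1 - h2)

/-! ### The entries of the transformed `L`-operator -/

lemma phiCoeff_alpha (η : ℝ) (n : ℕ) (c : ℂ) (k k' : ℤ) :
    phiCoeff η n c (k - 1) (k' - 1) = cexp (-(2 * Real.pi * I * n * η)) * phiCoeff η n c k k' := by
  rw [phiCoeff, phiCoeff, ← mul_assoc, ← Complex.exp_add, sub_sub_sub_cancel_right]
  push_cast
  ring_nf

lemma phiCoeff_delta (η : ℝ) (n : ℕ) (c : ℂ) (k k' : ℤ) :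
    phiCoeff η n c (k + 1) (k' + 1) = cexp (2 * Real.pi * I * n * η) * phiCoeff η n c k k' := by
  rw [phiCoeff, phiCoeff, ← mul_assoc, ← Complex.exp_add, add_sub_add_right_eq_sub]
  push_cast
  ring_nf

lemma phiCoeff_gamma {sp sm c : ℂ} (hc : c ^ 2 = -cexp (Real.pi * I * (sp - sm))) (η : ℝ) (n : ℕ)
    (k k' : ℤ) : phiCoeff η n c (k + 1) (k' - 1)
      = -cexp (Real.pi * I * (sp - sm)) * phiCoeff η n c k k' := by
  have hc0 : c ≠ 0 := by
    rintro rfl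
    exact Complex.exp_ne_zero (Real.pi * I * (sp - sm)) (by simp at hc)
  rw [phiCoeff, phiCoeff, ← hc, show k + 1 - (k' - 1) = k - k' + 2 by ring, zpow_add₀ hc0]
  push_cast
  rw [zpow_ofNat, show (k : ℂ) + 1 + (k' - 1) = k + k' by ring]
  ring

lemma phiCoeff_beta {sp sm c : ℂ} (hc : c ^ 2 = -cexp (Real.pi * I * (sp - sm))) (η : ℝ) (n : ℕ)
    (k k' : ℤ) : phiCoeff η n c (k - 1) (k' + 1)
      = -cexp (Real.pi * I * (sm - sp)) * phiCoeff η n c k k' := by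
  have h := phiCoeff_gamma hc η n (k - 1) (k' + 1)
  have e : cexp (Real.pi * I * (sm - sp)) * cexp (Real.pi * I * (sp - sm)) = 1 := by
    rw [← Complex.exp_add, ← Complex.exp_zero]; ring_nf
  rw [sub_add_cancel, add_sub_cancel_right] at h
  rw [h]
  linear_combination -phiCoeff η n c (k - 1) (k' + 1) * e

section entries

variable {n : ℕ} {t η : ℝ} (ht : 0 < t) (hη : ∀ m : ℤ, 2 * η ≠ m) {sp sm c lam : ℂ} {A B : ℕ}
  {k k' : ℤ} (hn : n = A + B) (hk : k = k' + A - B)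
  (hΔ : th t 1 1 ((sp - sm) / 2 - lam) ≠ 0) (hw : th t 1 1 (wPar t η sp sm k) ≠ 0)
include ht hη hn hk hΔ hw

theorem twistedL_alpha :
    twistedL t η n sp sm lam k k' 0 0 (phi t η n sp sm c 0 k k')
      = faceW t η n sp sm lam k k' 0 0 • phi t η n sp sm c 0 (k - 1) (k' - 1) := by
  have hκ := gaugeConst_ne_zero ht
  have hnC : (n : ℂ) = A + B := by exact_mod_cast hn
  have hkC : (k : ℂ) = k' + A - B := by rw [hk]; push_cast; ring
  have hφ : phi t η n sp sm c 0 k k' ∈ thetaSpace t n :=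
    phi_mem ht ⟨A, by omega, by push_cast [hn]; omega⟩
  obtain ⟨x, hx⟩ : ∃ x, x = sp / 2 + tau t / 4 + (k' - (n : ℂ) / 2) * η := ⟨_, rfl⟩
  obtain ⟨y, hy⟩ : ∃ y, y = sm / 2 + tau t / 4 + (k - (n : ℂ) / 2) * η := ⟨_, rfl⟩
  have e1 := phi_eq (t := t) (η := η) (sp := sp) (sm := sm) (c := c) (mu := 0) (k := k) (k' := k')
    (x := x + η) (y := y + η) hn (by omega) (by rw [hx]; ring) (by rw [hy]; ring)
  have e2 := phi_eq (t := t) (η := η) (sp := sp) (sm := sm) (c := c) (mu := 0) (k := k - 1)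
    (k' := k' - 1) (x := x) (y := y) hn (by omega) (by rw [hx]; push_cast; ring)
    (by rw [hy]; push_cast; ring)
  refine twistedL_eq_smul ht hη hφ (gaugeM_inv_row_zero ht η sp sm lam k hw hΔ)
    (gaugeM_col_zero ht η sp sm lam k') (F := fun z => phiCoeff η n c k k' *
      (th t 0 0 (-z + (y + (A + B) * η + lam)) * th t 0 0 (z + y)
        * (th t 0 0 (z + x) * th t 0 0 (-z + (x + (A + B) * η - lam)))
        * (thetaString t η (x + η) A (z + η) * thetaString t η (y + η) B (z + η))))
    (fun z => ?_) (differentiable_phi ht _ _ _ _ _ _ _ _) (fun z => ?_)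
  · rw [e1, show (sm + lam + 2 * k * η) / 2 + tau t / 4 + (lam / 2 - z + n / 2 * η)
        = -z + (y + (A + B) * η + lam) by rw [hy, hnC]; ring,
      show (sm + lam + 2 * k * η) / 2 + tau t / 4 - (lam / 2 - z + n / 2 * η)
        = z + y by rw [hy, hnC]; ring,
      show (sp - lam + 2 * k' * η) / 2 + tau t / 4 + (lam / 2 + z - n / 2 * η)
        = z + x by rw [hx, hnC]; ring,
      show (sp - lam + 2 * k' * η) / 2 + tau t / 4 - (lam / 2 + z - n / 2 * η)
        = -z + (x + (A + B) * η - lam) by rw [hx, hnC]; ring]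
    ring
  · have key := antisymm_alpha ht η x y lam A B z
    rw [show x + y + 2 * (A + B) * η = wPar t η sp sm ((k + k' + n) / 2) + tau t by
        rw [hx, hy, hnC, wPar, hkC]; ring,
      show x - y + (A - B) * η - lam = (sp - sm) / 2 - lam by rw [hx, hy, hkC]; ring,
      show ((A : ℂ) - B) * η = (k - k') * η by rw [hkC]; ring, th_add_tau] at key
    have e : cexp (Real.pi * I * (sm + lam + 2 * k * η))
        * cexp (Real.pi * I * (sp - lam + 2 * k' * η))
        * cexp (-Real.pi * I * (tau t + 2 * wPar t η sp sm ((k + k' + n) / 2)))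
        = cexp (-(2 * Real.pi * I * n * η)) := by
      rw [← Complex.exp_add, ← Complex.exp_add, wPar]
      ring_nf
    simp only [e2, neg_neg, faceW, Matrix.of_apply, Matrix.cons_val_zero, Matrix.cons_val',
      Matrix.cons_val_fin_one]
    rw [← mul_sub, key, phiCoeff_alpha, ← e]
    generalize th t 1 1 ((sp - sm) / 2 - lam) = Δ at hΔ ⊢
    field_simp

theorem twistedL_beta (hc : c ^ 2 = -cexp (Real.pi * I * (sp - sm)))
    (hw' : th t 1 1 (wPar t η sp sm k') ≠ 0) :
    twistedL t η n sp sm lam k k' 0 1 (phi t η n sp sm c 0 k k')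
      = faceW t η n sp sm lam k k' 0 1 • phi t η n sp sm c 0 (k - 1) (k' + 1) := by
  have hκ := gaugeConst_ne_zero ht
  have hnC : (n : ℂ) = A + B := by exact_mod_cast hn
  have hkC : (k : ℂ) = k' + A - B := by rw [hk]; push_cast; ring
  have hφ : phi t η n sp sm c 0 k k' ∈ thetaSpace t n :=
    phi_mem ht ⟨A, by omega, by push_cast [hn]; omega⟩
  obtain ⟨x, hx⟩ : ∃ x, x = sp / 2 + tau t / 4 + (k' - (n : ℂ) / 2) * η := ⟨_, rfl⟩
  obtain ⟨y, hy⟩ : ∃ y, y = sm / 2 + tau t / 4 + (k - (n : ℂ) / 2) * η := ⟨_, rfl⟩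
  have e1 := phi_eq (t := t) (η := η) (sp := sp) (sm := sm) (c := c) (mu := 0) (k := k) (k' := k')
    (x := x + η) (y := y + η) hn (by omega) (by rw [hx]; ring) (by rw [hy]; ring)
  refine twistedL_eq_smul ht hη hφ (gaugeM_inv_row_zero ht η sp sm lam k hw hΔ)
    (gaugeM_col_one ht η sp sm lam k') (F := fun z => phiCoeff η n c k k' *
      (th t 0 0 (-z + (y + (A + B) * η + lam)) * th t 0 0 (z + y)
        * (th t 0 0 (z + (y + (B - A) * η + lam)) * th t 0 0 (-z + (y + 2 * B * η)))
        * (thetaString t η (x + η) A (z + η) * thetaString t η (y + η) B (z + η))))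
    (fun z => ?_) (differentiable_phi ht _ _ _ _ _ _ _ _) (fun z => ?_)
  · rw [e1, show (sm + lam + 2 * k * η) / 2 + tau t / 4 + (lam / 2 - z + n / 2 * η)
        = -z + (y + (A + B) * η + lam) by rw [hy, hnC]; ring,
      show (sm + lam + 2 * k * η) / 2 + tau t / 4 - (lam / 2 - z + n / 2 * η)
        = z + y by rw [hy, hnC]; ring,
      show (sm + lam + 2 * k' * η) / 2 + tau t / 4 + (lam / 2 + z - n / 2 * η)
        = z + (y + (B - A) * η + lam) by rw [hy, hnC, hkC]; ring,
      show (sm + lam + 2 * k' * η) / 2 + tau t / 4 - (lam / 2 + z - n / 2 * η)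
        = -z + (y + 2 * B * η) by rw [hy, hnC, hkC]; ring]
    ring
  · have hcoef : ((k' : ℂ) - k - n) * η = -(2 * A * η) := by rw [hnC, hkC]; ring
    simp only [neg_neg, faceW, Matrix.of_apply, Matrix.cons_val_zero, Matrix.cons_val_one,
      Matrix.cons_val', Matrix.cons_val_fin_one, hcoef, th_one_one_neg]
    rw [← mul_sub]
    cases A with
    | zero =>
      -- Both sides vanish, the right-hand side because its coefficient contains `θ₁₁(0)`.
      rw [antisymm_beta_zero]
      simp [th_one_one_zero]
    | succ A =>
      have e2 := phi_eq (t := t) (η := η) (n := n) (sp := sp) (sm := sm) (c := c) (mu := 0)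
        (k := k - 1) (k' := k' + 1) (A := A) (B := B + 1) (x := x + 2 * η) (y := y)
        (by omega) (by push_cast at hk ⊢; omega)
        (by rw [hx]; push_cast; ring) (by rw [hy]; push_cast; ring)
      have key := antisymm_beta ht η x y lam A B z
      rw [show x + y + ((A + 1 : ℕ) + B) * η + lam
          = wPar t η sp sm ((k + k') / 2) + lam + tau t by
          rw [hx, hy, hnC, wPar, hkC]; ring,
        show x - y + ((A + 1 : ℕ) - B) * η - lam = (sp - sm) / 2 - lam by
          rw [hx, hy, hkC]; ring, th_add_tau] at key
      have e : cexp (Real.pi * I * (sm + lam + 2 * k * η))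
          * cexp (Real.pi * I * (sm + lam + 2 * k' * η))
          * cexp (-Real.pi * I * (tau t + 2 * (wPar t η sp sm ((k + k') / 2) + lam)))
          = cexp (Real.pi * I * (sm - sp)) := by
        rw [← Complex.exp_add, ← Complex.exp_add, wPar]
        ring_nf
      rw [key, e2, phiCoeff_beta hc, ← e]
      generalize th t 1 1 ((sp - sm) / 2 - lam) = Δ at hΔ ⊢
      field_simp

theorem twistedL_gamma (hc : c ^ 2 = -cexp (Real.pi * I * (sp - sm))) :
    twistedL t η n sp sm lam k k' 1 0 (phi t η n sp sm c 0 k k')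
      = faceW t η n sp sm lam k k' 1 0 • phi t η n sp sm c 0 (k + 1) (k' - 1) := by
  have hκ := gaugeConst_ne_zero ht
  have hnC : (n : ℂ) = A + B := by exact_mod_cast hn
  have hkC : (k : ℂ) = k' + A - B := by rw [hk]; push_cast; ring
  have hφ : phi t η n sp sm c 0 k k' ∈ thetaSpace t n :=
    phi_mem ht ⟨A, by omega, by push_cast [hn]; omega⟩
  obtain ⟨x, hx⟩ : ∃ x, x = sp / 2 + tau t / 4 + (k' - (n : ℂ) / 2) * η := ⟨_, rfl⟩
  obtain ⟨y, hy⟩ : ∃ y, y = sm / 2 + tau t / 4 + (k - (n : ℂ) / 2) * η := ⟨_, rfl⟩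
  have e1 := phi_eq (t := t) (η := η) (sp := sp) (sm := sm) (c := c) (mu := 0) (k := k) (k' := k')
    (x := x + η) (y := y + η) hn (by omega) (by rw [hx]; ring) (by rw [hy]; ring)
  refine twistedL_eq_smul ht hη hφ (gaugeM_inv_row_one ht η sp sm lam k hw hΔ)
    (gaugeM_col_zero ht η sp sm lam k') (F := fun z => phiCoeff η n c k k' *
      (th t 0 0 (-z + (x + 2 * A * η)) * th t 0 0 (z + (x + (A - B) * η - lam))
        * (th t 0 0 (z + x) * th t 0 0 (-z + (x + (A + B) * η - lam)))
        * (thetaString t η (x + η) A (z + η) * thetaString t η (y + η) B (z + η))))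
    (fun z => ?_) (differentiable_phi ht _ _ _ _ _ _ _ _) (fun z => ?_)
  · rw [e1, show (sp - lam + 2 * k * η) / 2 + tau t / 4 + (lam / 2 - z + n / 2 * η)
        = -z + (x + 2 * A * η) by rw [hx, hnC, hkC]; ring,
      show (sp - lam + 2 * k * η) / 2 + tau t / 4 - (lam / 2 - z + n / 2 * η)
        = z + (x + (A - B) * η - lam) by rw [hx, hnC, hkC]; ring,
      show (sp - lam + 2 * k' * η) / 2 + tau t / 4 + (lam / 2 + z - n / 2 * η)
        = z + x by rw [hx, hnC]; ring,
      show (sp - lam + 2 * k' * η) / 2 + tau t / 4 - (lam / 2 + z - n / 2 * η)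
        = -z + (x + (A + B) * η - lam) by rw [hx, hnC]; ring]
    ring
  · have hcoef : ((k : ℂ) - k' - n) * η = -2 * B * η := by rw [hnC, hkC]; ring
    simp only [neg_neg, faceW, Matrix.of_apply, Matrix.cons_val_zero, Matrix.cons_val_one,
      Matrix.cons_val', Matrix.cons_val_fin_one, hcoef]
    rw [← mul_sub]
    cases B with
    | zero =>
      -- Both sides vanish, the right-hand side because its coefficient contains `θ₁₁(0)`.
      rw [antisymm_gamma_zero]
      simp [th_one_one_zero]
    | succ B =>
      have e2 := phi_eq (t := t) (η := η) (n := n) (sp := sp) (sm := sm) (c := c) (mu := 0)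
        (k := k + 1) (k' := k' - 1) (A := A + 1) (B := B) (x := x) (y := y + 2 * η)
        (by omega) (by push_cast at hk ⊢; omega)
        (by rw [hx]; push_cast; ring) (by rw [hy]; push_cast; ring)
      have key := antisymm_gamma ht η x y lam A B z
      rw [show x + y + (A + (B + 1 : ℕ)) * η - lam
          = wPar t η sp sm ((k + k') / 2) - lam + tau t by
          rw [hx, hy, hnC, wPar, hkC]; ring,
        show x - y + (A - (B + 1 : ℕ)) * η - lam = (sp - sm) / 2 - lam by
          rw [hx, hy, hkC]; ring, th_add_tau] at key
      have e : cexp (Real.pi * I * (sp - lam + 2 * k * η))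
          * cexp (Real.pi * I * (sp - lam + 2 * k' * η))
          * cexp (-Real.pi * I * (tau t + 2 * (wPar t η sp sm ((k + k') / 2) - lam)))
          = cexp (Real.pi * I * (sp - sm)) := by
        rw [← Complex.exp_add, ← Complex.exp_add, wPar]
        ring_nf
      rw [key, e2, phiCoeff_gamma hc, ← e]
      generalize th t 1 1 ((sp - sm) / 2 - lam) = Δ at hΔ ⊢
      field_simp

theorem twistedL_delta (hw' : th t 1 1 (wPar t η sp sm k') ≠ 0) :
    twistedL t η n sp sm lam k k' 1 1 (phi t η n sp sm c 0 k k')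
      = faceW t η n sp sm lam k k' 1 1 • phi t η n sp sm c 0 (k + 1) (k' + 1) := by
  have hκ := gaugeConst_ne_zero ht
  have hnC : (n : ℂ) = A + B := by exact_mod_cast hn
  have hkC : (k : ℂ) = k' + A - B := by rw [hk]; push_cast; ring
  have hφ : phi t η n sp sm c 0 k k' ∈ thetaSpace t n :=
    phi_mem ht ⟨A, by omega, by push_cast [hn]; omega⟩
  obtain ⟨x, hx⟩ : ∃ x, x = sp / 2 + tau t / 4 + (k' - (n : ℂ) / 2) * η := ⟨_, rfl⟩
  obtain ⟨y, hy⟩ : ∃ y, y = sm / 2 + tau t / 4 + (k - (n : ℂ) / 2) * η := ⟨_, rfl⟩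
  have e1 := phi_eq (t := t) (η := η) (sp := sp) (sm := sm) (c := c) (mu := 0) (k := k) (k' := k')
    (x := x + η) (y := y + η) hn (by omega) (by rw [hx]; ring) (by rw [hy]; ring)
  have e2 := phi_eq (t := t) (η := η) (sp := sp) (sm := sm) (c := c) (mu := 0) (k := k + 1)
    (k' := k' + 1) (x := x + 2 * η) (y := y + 2 * η) hn (by omega)
    (by rw [hx]; push_cast; ring) (by rw [hy]; push_cast; ring)
  refine twistedL_eq_smul ht hη hφ (gaugeM_inv_row_one ht η sp sm lam k hw hΔ)
    (gaugeM_col_one ht η sp sm lam k') (F := fun z => phiCoeff η n c k k' *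
      (th t 0 0 (-z + (x + 2 * A * η)) * th t 0 0 (z + (x + (A - B) * η - lam))
        * (th t 0 0 (z + (y + (B - A) * η + lam)) * th t 0 0 (-z + (y + 2 * B * η)))
        * (thetaString t η (x + η) A (z + η) * thetaString t η (y + η) B (z + η))))
    (fun z => ?_) (differentiable_phi ht _ _ _ _ _ _ _ _) (fun z => ?_)
  · rw [e1, show (sp - lam + 2 * k * η) / 2 + tau t / 4 + (lam / 2 - z + n / 2 * η)
        = -z + (x + 2 * A * η) by rw [hx, hnC, hkC]; ring,
      show (sp - lam + 2 * k * η) / 2 + tau t / 4 - (lam / 2 - z + n / 2 * η)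
        = z + (x + (A - B) * η - lam) by rw [hx, hnC, hkC]; ring,
      show (sm + lam + 2 * k' * η) / 2 + tau t / 4 + (lam / 2 + z - n / 2 * η)
        = z + (y + (B - A) * η + lam) by rw [hy, hnC, hkC]; ring,
      show (sm + lam + 2 * k' * η) / 2 + tau t / 4 - (lam / 2 + z - n / 2 * η)
        = -z + (y + 2 * B * η) by rw [hy, hnC, hkC]; ring]
    ring
  · have key := antisymm_delta ht η x y lam A B z
    rw [show x + y = wPar t η sp sm ((k + k' - n) / 2) + tau t by
        rw [hx, hy, hnC, wPar, hkC]; ring,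
      show x - y + (A - B) * η - lam = (sp - sm) / 2 - lam by rw [hx, hy, hkC]; ring,
      show ((A : ℂ) - B) * η = (k - k') * η by rw [hkC]; ring, th_add_tau, th_one_one_neg] at key
    have e : cexp (Real.pi * I * (sp - lam + 2 * k * η))
        * cexp (Real.pi * I * (sm + lam + 2 * k' * η))
        * cexp (-Real.pi * I * (tau t + 2 * wPar t η sp sm ((k + k' - n) / 2)))
        = cexp (2 * Real.pi * I * n * η) := by
      rw [← Complex.exp_add, ← Complex.exp_add, wPar]
      ring_nf
    simp only [e2, neg_neg, faceW, Matrix.of_apply, Matrix.cons_val_one, Matrix.cons_val',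
      Matrix.cons_val_fin_one]
    rw [← mul_sub, show ((A : ℂ) - B) * η = (k - k') * η by rw [hkC]; ring, key, phiCoeff_delta,
      ← e]
    generalize th t 1 1 ((sp - sm) / 2 - lam) = Δ at hΔ ⊢
    field_simp

end entries

end EightVertex

open EightVertex
theorem mainTheorem2 (n : ℕ) (t η : ℝ) (ht : 0 < t) (hη : ∀ m : ℤ, 2 * η ≠ m)
    (sp sm c : ℂ) (hc : c ^ 2 = -Complex.exp (Real.pi * Complex.I * (sp - sm))) :
    -- the Sklyanin generators act on the representation space
    (∀ a : Fin 4, ∀ f ∈ thetaSpace t n, sklyaninOp t η n a f ∈ thetaSpace t n) ∧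
    ∀ k k' : ℤ, Admissible n k k' →
      -- the intertwining vectors lie in the representation space
      (∀ mu : ℂ, phi t η n sp sm c mu k k' ∈ thetaSpace t n) ∧
      -- the vertex-face correspondence, whenever the gauge transformation is defined
      ∀ lam : ℂ, th t 1 1 (wPar t η sp sm k) ≠ 0 → th t 1 1 (wPar t η sp sm k') ≠ 0 →
        (gaugeM t η sp sm lam k).det ≠ 0 →
          twistedL t η n sp sm lam k k' 0 0 (phi t η n sp sm c 0 k k')
            = faceW t η n sp sm lam k k' 0 0 • phi t η n sp sm c 0 (k - 1) (k' - 1) ∧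
          twistedL t η n sp sm lam k k' 0 1 (phi t η n sp sm c 0 k k')
            = faceW t η n sp sm lam k k' 0 1 • phi t η n sp sm c 0 (k - 1) (k' + 1) ∧
          twistedL t η n sp sm lam k k' 1 0 (phi t η n sp sm c 0 k k')
            = faceW t η n sp sm lam k k' 1 0 • phi t η n sp sm c 0 (k + 1) (k' - 1) ∧
          twistedL t η n sp sm lam k k' 1 1 (phi t η n sp sm c 0 k k')
            = faceW t η n sp sm lam k k' 1 1 • phi t η n sp sm c 0 (k + 1) (k' + 1) := by
  refine ⟨fun a f hf => sklyaninOp_mem ht η a hf, fun k k' hkk => ⟨fun mu => phi_mem ht hkk,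
    fun lam hw hw' hdet => ?_⟩⟩
  have hΔ : th t 1 1 ((sp - sm) / 2 - lam) ≠ 0 := by
    rw [gaugeM_det ht η sp sm lam k hw] at hdet
    exact right_ne_zero_of_mul hdet
  obtain ⟨A, hA, hk⟩ := hkk
  obtain ⟨B, hB⟩ := Nat.exists_eq_add_of_le hA
  have hk' : k = k' + A - B := by rw [hB] at hk; push_cast at hk; omega
  exact ⟨twistedL_alpha ht hη hB hk' hΔ hw, twistedL_beta ht hη hB hk' hΔ hw hc hw',
    twistedL_gamma ht hη hB hk' hΔ hw hc, twistedL_delta ht hη hB hk' hΔ hw hw'⟩
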